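/- Let $k$ be a commutative ring and $A$ an associative unital $k$-algebra with an augmentation $\varepsilon : A \to k$ (a homomorphism of unital $k$-algebras), and let $I = \ker\varepsilon$. Let $\Delta S_+$ be the category with objects $[n] = \{0,\dots,n\}$, $n \ge -1$ (so $[-1]=\emptyset$), in which a morphism $[n]\to[m]$ is a map of sets together with a total ordering of each of its fibres; equivalently it is a sequence $X_0\otimes\cdots\otimes X_m$ of monomials in noncommuting variables $x_0,\dots,x_n$ in which each variable occurs exactly once in total, and composition is substitution. Let $\Delta S\subset\Delta S_+$ be the full subcategory on the objects $[n]$, $n\ge 0$, let $\Delta_+\subset\Delta S_+$ be the subcategory of morphisms whose variables occur in the order $x_0,x_1,\dots$, and let $\mathrm{Epi}\Delta S_+\subset \Delta S_+$ be the subcategory with the same objects and with the epimorphisms as morphisms. Let $B^{sym_+}_*A : \Delta S_+\to k\text{-}\mathbf{Mod}$ be the functor $[n]\mapsto A^{\otimes (n+1)}$ ($[-1]\mapsto k$) on which a morphism $\alpha$ acts by $a_0\otimes\cdots\otimes a_n\mapsto \alpha(a_0,\dots,a_n)$, the empty monomial being replaced by $1_A$; let $B^{sym}_*A$ be its restriction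 to $\Delta S$, and let $B^{sym_+}_*I : \mathrm{Epi}\Delta S_+\to k\text{-}\mathbf{Mod}$ be the functor $[n]\mapsto I^{\otimes(n+1)}$ ($[-1]\mapsto k$) defined by the same formula. The symmetric homology of $A$ is $HS_*(A)=\mathrm{Tor}_*^{\Delta S}(\underline{k},B^{sym}_*A)$, the left derived functors of $-\otimes_{\Delta S}B^{sym}_*A$ evaluated at the constant functor $\underline{k}$. For a category $\mathscr{C}$ let $N(-\setminus\mathscr{C})$ be the nerve of the under-category, and consider the simplicial $k$-modules \[ \mathscr{Y}^+_*A = k[N(-\setminus\Delta S_+)]\otimes_{\Delta S_+}B^{sym_+}_*A,\qquad \mathscr{Y}^{epi}_*A = k[N(-\setminus\mathrm{Epi}\Delta S_+)]\otimes_{\mathrm{Epi}\Delta S_+}B^{sym_+}_*I . \] Then: (1) for every $n\ge 0$ there is an isomorphism of $k$-modules $HS_n(A)\cong H_n(\mathscr{Y}^{epi}_*A)$, where the differential of $\mathscr{Y}^{epi}_*A$ is the alternating sum of the face maps; (2) the map $f:\mathscr{Y}^{epi}_*A\to\mathscr{Y}^+_*A$ induced by the inclusions $\mathrm{Epi}\Delta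 S_+\subset\Delta S_+$ and $I\subset A$ is a homotopy equivalence. Explicitly, there are a simplicial map $g:\mathscr{Y}^+_*A\to\mathscr{Y}^{epi}_*A$ with $gf=\mathrm{id}$ and a simplicial homotopy $h=(h_j)$ with $d_0h_0=\mathrm{id}$ and $d_{n+1}h_n=fg$ in degree $n$ (in particular a presimplicial homotopy between $fg$ and $\mathrm{id}$), such that for every chain $[q]\to[q_0]\to\cdots\to[q_n]$ in $\Delta S_+$ and every $Y\in I^{\otimes(q+1)}$ (with $I^{\otimes 0}=k$) \[ g\big([q]\to[q_0]\to\cdots\to[q_n]\otimes Y\big)=[q]\twoheadrightarrow[r_0]\twoheadrightarrow\cdots\twoheadrightarrow[r_n]\otimes Y, \] \[ h_j\big([q]\to[q_0]\to\cdots\to[q_n]\otimes Y\big)=[q]\twoheadrightarrow[r_0]\twoheadrightarrow\cdots\twoheadrightarrow[r_j]\hookrightarrow[q_j]\to\cdots\to[q_n]\otimes Y\qquad(0\le j\le n), \] where $[q]\twoheadrightarrow[r_i]\hookrightarrow[q_i]$ is the factorization of $[q]\to[q_i]$ into an epimorphism of $\Delta S_+$ followed by a monomorphism lying in $\Delta_+$,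 and the maps $[r_i]\twoheadrightarrow[r_{i+1}]$ are epimorphisms compatible with these factorizations and with $[q_i]\to[q_{i+1}]$. -/

import Mathlib

open CategoryTheory Opposite Simplicial TensorProduct

universe u

/-! ### The categories of noncommutative sets -/

/-- A morphism from a set of `p` points to a set of `q` points in tensor notation
`X_0 ⊗ ⋯ ⊗ X_{q-1}`: each `X_i = word i` is a monomial in noncommuting variables
`x_0, …, x_{p-1}` (the empty monomial being `1`), and every variable occurs exactly once in total.
The underlying set map sends `j` to the `i` with `x_j` in `X_i`, and `X_i` records the total order
on the fibre over `i`. -/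
@[ext]
structure TensorMor (p q : ℕ) where
  word : Fin q → List (Fin p)
  count_eq_one : ∀ j : Fin p, ∑ i, (word i).count j = 1

namespace TensorMor

theorem sum_count_flatMap {p q r : ℕ} (f : TensorMor p q) (g : TensorMor q r) (j : Fin p) :
    ∑ i, ((g.word i).flatMap f.word).count j = 1 := by
  have key : ∀ l : List (Fin q),
      (l.flatMap f.word).count j = ∑ m, l.count m * (f.word m).count j := by
    intro l
    rw [List.count_flatMap]
    induction l with
    | nil => simp
    | cons a l ih =>
      simp only [List.map_cons, List.sum_cons, ih, List.count_cons, add_mul, Finset.sum_add_distrib]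
      rw [add_comm]
      congr 1
      simp
  simp only [key]
  rw [Finset.sum_comm]
  simp only [← Finset.sum_mul, g.count_eq_one, one_mul, f.count_eq_one]

/-- The identity `x_0 ⊗ ⋯ ⊗ x_{p-1}`. -/
def id (p : ℕ) : TensorMor p p where
  word i := [i]
  count_eq_one j := by simp [List.count_singleton]

/-- Composition by substitution: every variable `x_m` in the monomials of `g` is replaced by the
`m`-th monomial of `f`. -/
def comp {p q r : ℕ} (f : TensorMor p q) (g : TensorMor q r) : TensorMor p r where
  word i := (g.word i).flatMap f.word
  count_eq_one := sum_count_flatMap f g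

end TensorMor

/-- The category `ΔS₊`: the object `[n]`, `n ≥ -1`, is the one with `card = n + 1`. -/
@[ext]
structure DeltaSPlus where
  card : ℕ

instance : SmallCategory DeltaSPlus where
  Hom X Y := TensorMor X.card Y.card
  id X := TensorMor.id X.card
  comp f g := TensorMor.comp f g
  id_comp f := by
    apply TensorMor.ext
    funext i
    simp [TensorMor.comp, TensorMor.id]
  comp_id f := by
    apply TensorMor.ext
    funext i
    simp [TensorMor.comp, TensorMor.id]
  assoc f g h := by
    apply TensorMor.ext
    funext i
    simp [TensorMor.comp, List.flatMap_assoc]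

/-- The category `ΔS`: the object `[n]`, `n ≥ 0`, is the one with `dim = n`, a set of `n + 1`
points. -/
@[ext]
structure DeltaS where
  dim : ℕ

instance : SmallCategory DeltaS where
  Hom X Y := TensorMor (X.dim + 1) (Y.dim + 1)
  id X := TensorMor.id (X.dim + 1)
  comp f g := TensorMor.comp f g
  id_comp {X Y} f := Category.id_comp (X := DeltaSPlus.mk (X.dim + 1))
    (Y := DeltaSPlus.mk (Y.dim + 1)) f
  comp_id {X Y} f := Category.comp_id (X := DeltaSPlus.mk (X.dim + 1))
    (Y := DeltaSPlus.mk (Y.dim + 1)) f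
  assoc {W X Y Z} f g h := Category.assoc (W := DeltaSPlus.mk (W.dim + 1))
    (X := DeltaSPlus.mk (X.dim + 1)) (Y := DeltaSPlus.mk (Y.dim + 1))
    (Z := DeltaSPlus.mk (Z.dim + 1)) f g h

/-- The inclusion `ΔS ⥤ ΔS₊`, `[n] ↦ [n]`. -/
def DeltaS.inclusion : DeltaS ⥤ DeltaSPlus where
  obj X := ⟨X.dim + 1⟩
  map f := f
  map_id _ := rfl
  map_comp _ _ := rfl

/-- `Epi ΔS₊`: all objects of `ΔS₊`, and the epimorphisms of `ΔS₊` as morphisms. -/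
abbrev EpiDeltaSPlus : Type := WideSubcategory (MorphismProperty.epimorphisms DeltaSPlus)

/-- The inclusion `Epi ΔS₊ ⥤ ΔS₊`. -/
abbrev EpiDeltaSPlus.inclusion : EpiDeltaSPlus ⥤ DeltaSPlus :=
  wideSubcategoryInclusion (MorphismProperty.epimorphisms DeltaSPlus)

/-- A morphism of `ΔS₊` lies in `Δ₊` (that is, it is an order preserving map with the standard
order on all its fibres) when its variables occur in the order `x_0, x_1, …`. -/
def DeltaSPlus.IsOrdered {X Y : DeltaSPlus} (f : X ⟶ Y) : Prop :=
  (List.ofFn (TensorMor.word f)).flatten = List.finRange X.card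

theorem DeltaSPlus.word_ne_nil_of_epi {X Y : DeltaSPlus} (f : X ⟶ Y) [Epi f] (i₀ : Fin Y.card) :
    TensorMor.word f i₀ ≠ [] := by
  intro h0
  let u : Y ⟶ DeltaSPlus.mk 2 :=
    { word := ![List.finRange _, []]
      count_eq_one := fun j => by
        have := List.count_eq_one_of_mem (List.nodup_finRange Y.card) (List.mem_finRange j)
        simp [Fin.sum_univ_two, this] }
  let v : Y ⟶ DeltaSPlus.mk 2 :=
    { word := ![(List.finRange _).filter (fun i => i ≠ i₀), [i₀]]
      count_eq_one := fun j => by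
        have h1 := List.count_eq_one_of_mem (List.nodup_finRange Y.card) (List.mem_finRange j)
        by_cases hj : j = i₀
        · subst hj
          simp [Fin.sum_univ_two, List.count_eq_zero]
        · have : i₀ ≠ j := fun h => hj h.symm
          simp only [Fin.sum_univ_two, Matrix.cons_val_zero, Matrix.cons_val_one]
          rw [List.count_filter (by simpa using hj), h1]
          simp [this] }
  have hfilter : ∀ l : List (Fin Y.card),
      (l.filter (fun i => i ≠ i₀)).flatMap (TensorMor.word f) = l.flatMap (TensorMor.word f) := by
    intro l
    induction l with
    | nil => rfl
    | cons a l ih =>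
      by_cases ha : a = i₀
      · subst ha
        simp only [List.flatMap_cons, h0, List.nil_append, ← ih]
        simp
      · rw [List.filter_cons_of_pos (by simpa using ha), List.flatMap_cons, List.flatMap_cons, ih]
  have huv : f ≫ u = f ≫ v := by
    apply TensorMor.ext
    funext i
    change Fin 2 at i
    change (TensorMor.word u i).flatMap (TensorMor.word f)
      = (TensorMor.word v i).flatMap (TensorMor.word f)
    fin_cases i
    · exact (hfilter _).symm
    · simp [u, v, h0]
  have h := congrArg (fun w : Y ⟶ DeltaSPlus.mk 2 => TensorMor.word w (1 : Fin 2))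
    ((cancel_epi f).1 huv)
  simp [u, v] at h

/-! ### The symmetric bar constructions -/

section Bar

variable (k : Type u) [CommRing k] (A : Type u) [Ring A] [Algebra k A]

variable {A} in
/-- The monomials of `f` evaluated at `(a_0, …, a_{p-1})`; the empty monomial gives `1`. -/
def TensorMor.eval {p q : ℕ} (f : TensorMor p q) (a : Fin p → A) (i : Fin q) : A :=
  ((f.word i).map a).prod

variable {A} in
theorem TensorMor.eval_update {p q : ℕ} (f : TensorMor p q) [DecidableEq (Fin p)]
    (a : Fin p → A) (j : Fin p) :
    ∃ (i₀ : Fin q) (s t : A), ∀ x : A,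
      f.eval (Function.update a j x) = Function.update (f.eval a) i₀ (s * x * t) := by
  obtain rfl : ‹DecidableEq (Fin p)› = instDecidableEqFin p := Subsingleton.elim _ _
  obtain ⟨i₀, hi₀⟩ : ∃ i, (f.word i).count j ≠ 0 := by
    by_contra! h
    have := f.count_eq_one j
    rw [Finset.sum_eq_zero (fun i _ => h i)] at this
    exact absurd this (by decide)
  have hsum := f.count_eq_one j
  rw [← Finset.add_sum_erase _ _ (Finset.mem_univ i₀)] at hsum
  have h1 : (f.word i₀).count j = 1 :=
    le_antisymm (le_of_le_of_eq (Nat.le_add_right _ _) hsum) (Nat.pos_of_ne_zero hi₀)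
  have h0 : ∑ i ∈ Finset.univ.erase i₀, (f.word i).count j = 0 := by
    rw [h1] at hsum
    exact Nat.add_left_cancel hsum
  rw [Finset.sum_eq_zero_iff] at h0
  obtain ⟨s, t, hst⟩ := List.append_of_mem (List.count_pos_iff.1 (Nat.pos_of_ne_zero hi₀))
  have hne : ∀ l : List (Fin p), l.count j = 0 →
      ∀ x, l.map (Function.update a j x) = l.map a := by
    intro l hl x
    apply List.map_congr_left
    intro b hb
    rw [Function.update_of_ne]
    rintro rfl
    exact List.count_eq_zero.1 hl hb
  rw [hst, List.count_append, List.count_cons_self] at h1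
  refine ⟨i₀, (s.map a).prod, (t.map a).prod, fun x => ?_⟩
  funext i
  by_cases hi : i = i₀
  · subst hi
    rw [Function.update_self, TensorMor.eval, hst]
    simp [hne s (by omega) x, hne t (by omega) x, mul_assoc]
  · rw [Function.update_of_ne hi, TensorMor.eval, TensorMor.eval,
      hne _ (h0 i (by simp [hi])) x]

theorem TensorMor.eval_comp {p q r : ℕ} (f : TensorMor p q) (g : TensorMor q r) (a : Fin p → A) :
    (f.comp g).eval a = g.eval (f.eval a) := by
  funext i
  change (((g.word i).flatMap f.word).map a).prod = ((g.word i).map (f.eval a)).prod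
  induction g.word i with
  | nil => simp
  | cons b l ih =>
    simp only [List.flatMap_cons, List.map_append, List.prod_append, List.map_cons, List.prod_cons,
      ih]
    rfl

theorem TensorMor.eval_id {p : ℕ} (a : Fin p → A) : (TensorMor.id p).eval a = a := by
  funext i
  simp [TensorMor.eval, TensorMor.id]

/-- The linear map `A^{⊗p} → A^{⊗q}`, `a_0 ⊗ ⋯ ⊗ a_{p-1} ↦ f(a_0, …, a_{p-1})`. -/
noncomputable def TensorMor.tensorMap {p q : ℕ} (f : TensorMor p q) :
    (⨂[k] _ : Fin p, A) →ₗ[k] (⨂[k] _ : Fin q, A) :=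
  PiTensorProduct.lift
    { toFun := fun a => PiTensorProduct.tprod k (f.eval a)
      map_update_add' := fun a j x y => by
        obtain ⟨i₀, s, t, h⟩ := f.eval_update a j
        simp only [h, mul_add, add_mul, MultilinearMap.map_update_add]
      map_update_smul' := fun a j c x => by
        obtain ⟨i₀, s, t, h⟩ := f.eval_update a j
        simp only [h, mul_smul_comm, smul_mul_assoc, MultilinearMap.map_update_smul] }

@[simp]
theorem TensorMor.tensorMap_tprod {p q : ℕ} (f : TensorMor p q) (a : Fin p → A) :
    f.tensorMap k A (PiTensorProduct.tprod k a) = PiTensorProduct.tprod k (f.eval a) :=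
  PiTensorProduct.lift.tprod _

/-- The functor `B^{sym₊}_* A : ΔS₊ ⥤ k-Mod`, `[n] ↦ A^{⊗(n+1)}`; in particular `[-1]` goes to the
empty tensor power, which is `k`, and `[-1] ⟶ [n]` to `λ ↦ λ (1 ⊗ ⋯ ⊗ 1)`. -/
noncomputable def symBarPlus : DeltaSPlus ⥤ ModuleCat.{u} k where
  obj X := ModuleCat.of k (⨂[k] _ : Fin X.card, A)
  map f := ModuleCat.ofHom (TensorMor.tensorMap k A f)
  map_id X := by
    have h : TensorMor.tensorMap k A (TensorMor.id X.card) = LinearMap.id := by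
      apply PiTensorProduct.ext
      ext a
      simp [TensorMor.eval_id]
    exact ModuleCat.hom_ext h
  map_comp f g := by
    have h : TensorMor.tensorMap k A (TensorMor.comp f g)
        = TensorMor.tensorMap k A g ∘ₗ TensorMor.tensorMap k A f := by
      apply PiTensorProduct.ext
      ext a
      simp [TensorMor.eval_comp]
    exact ModuleCat.hom_ext h

/-- The symmetric bar construction `B^{sym}_* A : ΔS ⥤ k-Mod`, `[n] ↦ A^{⊗(n+1)}`. -/
noncomputable def symBar : DeltaS ⥤ ModuleCat.{u} k :=
  DeltaS.inclusion ⋙ symBarPlus k A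

variable {k A}
variable (ε : A →ₐ[k] k)

/-- The augmentation ideal of an augmented algebra, as a `k`-module. -/
abbrev augIdeal : Submodule k A := LinearMap.ker ε.toLinearMap

theorem augIdeal_list_prod_mem {p : ℕ} (l : List (Fin p)) (hl : l ≠ [])
    (a : Fin p → augIdeal ε) : (l.map (fun j => (a j : A))).prod ∈ augIdeal ε := by
  cases l with
  | nil => exact absurd rfl hl
  | cons b l =>
    have hb : ε (a b) = 0 := (a b).2
    simp [hb]

/-- The linear map `I^{⊗p} → I^{⊗q}`, `a_0 ⊗ ⋯ ⊗ a_{p-1} ↦ f(a_0, …, a_{p-1})`, for `f` without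
empty monomials. -/
noncomputable def augTensorMap {p q : ℕ} (f : TensorMor p q) (hf : ∀ i, f.word i ≠ []) :
    (⨂[k] _ : Fin p, augIdeal ε) →ₗ[k] (⨂[k] _ : Fin q, augIdeal ε) :=
  have key : ∀ [DecidableEq (Fin p)] (a : Fin p → augIdeal ε) (j : Fin p),
      ∃ (i₀ : Fin q) (T : augIdeal ε →ₗ[k] augIdeal ε), ∀ x : augIdeal ε,
        (fun i => (⟨f.eval (fun m => (Function.update a j x m : A)) i,
          augIdeal_list_prod_mem ε _ (hf i) (Function.update a j x)⟩ : augIdeal ε)) =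
        Function.update (fun i => (⟨f.eval (fun m => (a m : A)) i,
          augIdeal_list_prod_mem ε _ (hf i) a⟩ : augIdeal ε)) i₀ (T x) := by
    intro _ a j
    obtain ⟨i₀, s, t, h⟩ := f.eval_update (fun m => (a m : A)) j
    refine ⟨i₀, ((LinearMap.mulLeftRight k (s, t)).restrict (p := augIdeal ε) (q := augIdeal ε)
      ?_), fun x => ?_⟩
    · intro x hx
      have hx' : ε x = 0 := hx
      simp [hx']
    · have hu : (fun m => (Function.update a j x m : A))
          = Function.update (fun m => (a m : A)) j (x : A) := by
        funext m
        by_cases hm : m = j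
        · subst hm; simp
        · simp [Function.update_of_ne hm]
      funext i
      apply Subtype.ext
      simp only [hu, h]
      by_cases hi : i = i₀
      · subst hi
        rw [Function.update_self, Function.update_self]
        rfl
      · simp [Function.update_of_ne hi]
  PiTensorProduct.lift
    { toFun := fun a => PiTensorProduct.tprod k (fun i =>
        (⟨f.eval (fun m => (a m : A)) i, augIdeal_list_prod_mem ε _ (hf i) a⟩ : augIdeal ε))
      map_update_add' := fun a j x y => by
        obtain ⟨i₀, T, h⟩ := key a j
        simp only [h, map_add, MultilinearMap.map_update_add]
      map_update_smul' := fun a j c x => by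
        obtain ⟨i₀, T, h⟩ := key a j
        simp only [h, map_smul, MultilinearMap.map_update_smul] }

@[simp]
theorem augTensorMap_tprod {p q : ℕ} (f : TensorMor p q) (hf : ∀ i, f.word i ≠ [])
    (a : Fin p → augIdeal ε) :
    augTensorMap ε f hf (PiTensorProduct.tprod k a) = PiTensorProduct.tprod k (fun i =>
      (⟨f.eval (fun m => (a m : A)) i, augIdeal_list_prod_mem ε _ (hf i) a⟩ : augIdeal ε)) :=
  PiTensorProduct.lift.tprod _

theorem EpiDeltaSPlus.word_ne_nil {X Y : EpiDeltaSPlus} (f : X ⟶ Y) (i : Fin Y.obj.card) :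
    TensorMor.word f.hom i ≠ [] :=
  have : Epi f.hom := f.property
  DeltaSPlus.word_ne_nil_of_epi f.hom i

/-- The functor `B^{sym₊}_* I : Epi ΔS₊ ⥤ k-Mod`, `[n] ↦ I^{⊗(n+1)}`, for the augmentation
ideal `I`. -/
noncomputable def symBarIdeal : EpiDeltaSPlus ⥤ ModuleCat.{u} k where
  obj X := ModuleCat.of k (⨂[k] _ : Fin X.obj.card, augIdeal ε)
  map f := ModuleCat.ofHom (augTensorMap ε f.hom (EpiDeltaSPlus.word_ne_nil f))
  map_id X := by
    have h : ∀ hf, augTensorMap ε (TensorMor.id X.obj.card) hf = LinearMap.id := by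
      intro hf
      apply PiTensorProduct.ext
      ext a
      simp [TensorMor.eval_id]
    exact ModuleCat.hom_ext (h (EpiDeltaSPlus.word_ne_nil (𝟙 X)))
  map_comp {X Y Z} f g := by
    have h : ∀ h₁ h₂ h₃, augTensorMap ε (TensorMor.comp f.hom g.hom) h₁
        = augTensorMap ε g.hom h₂ ∘ₗ augTensorMap ε f.hom h₃ := by
      intro h₁ h₂ h₃
      apply PiTensorProduct.ext
      ext a
      simp [TensorMor.eval_comp]
    exact ModuleCat.hom_ext (h (EpiDeltaSPlus.word_ne_nil (f ≫ g)) (EpiDeltaSPlus.word_ne_nil g)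
      (EpiDeltaSPlus.word_ne_nil f))

/-- The inclusion `I^{⊗(n+1)} → A^{⊗(n+1)}`, natural on `Epi ΔS₊`. -/
noncomputable def symBarIdealInclusion :
    symBarIdeal ε ⟶ EpiDeltaSPlus.inclusion ⋙ symBarPlus k A where
  app X := ModuleCat.ofHom (PiTensorProduct.map (fun _ => (augIdeal ε).subtype))
  naturality X Y f := by
    have h : ∀ h₁, PiTensorProduct.map (fun _ => (augIdeal ε).subtype) ∘ₗ
          augTensorMap ε f.hom h₁
        = TensorMor.tensorMap k A f.hom ∘ₗ
          PiTensorProduct.map (fun _ => (augIdeal ε).subtype) := by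
      intro h₁
      apply PiTensorProduct.ext
      ext a
      simp [PiTensorProduct.map_tprod]
    exact ModuleCat.hom_ext (h (EpiDeltaSPlus.word_ne_nil f))

end Bar

/-! ### Tensor products over a category -/

section CatTensor

open scoped Classical in
/-- The relations `y ⊗ f_* x ≈ f^* y ⊗ x`, for `f : X ⟶ Y`, `x ∈ N(X)` and `y ∈ M(Y)`, defining the
tensor product over `C`. -/
def CatTensor.relations {k : Type u} [CommRing k] {C : Type} [SmallCategory C]
    (M : Cᵒᵖ ⥤ ModuleCat.{u} k) (N : C ⥤ ModuleCat.{u} k) :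
    Submodule k (DirectSum C fun X => M.obj (op X) ⊗[k] N.obj X) :=
  Submodule.span k {z | ∃ (X Y : C) (f : X ⟶ Y) (x : N.obj X) (y : M.obj (op Y)),
    z = DirectSum.lof k C (fun X => M.obj (op X) ⊗[k] N.obj X) Y (y ⊗ₜ[k] (N.map f).hom x)
      - DirectSum.lof k C (fun X => M.obj (op X) ⊗[k] N.obj X) X ((M.map f.op).hom y ⊗ₜ[k] x)}

variable {k : Type u} [CommRing k] {C : Type} [SmallCategory C]

/-- The tensor product `M ⊗_C N = (⨁_X M(X) ⊗ N(X)) / ≈` of a `Cᵒᵖ`-module `M` and a `C`-module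
`N`. -/
abbrev CatTensor (M : Cᵒᵖ ⥤ ModuleCat.{u} k) (N : C ⥤ ModuleCat.{u} k) : Type u :=
  (DirectSum C fun X => M.obj (op X) ⊗[k] N.obj X) ⧸ CatTensor.relations M N

namespace CatTensor

variable {M M' : Cᵒᵖ ⥤ ModuleCat.{u} k} {N : C ⥤ ModuleCat.{u} k}

open scoped Classical in
/-- The class of `y ⊗ x` in `M ⊗_C N`, for `y ∈ M(X)` and `x ∈ N(X)`. -/
noncomputable def tmul (M : Cᵒᵖ ⥤ ModuleCat.{u} k) (N : C ⥤ ModuleCat.{u} k) (X : C)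
    (y : M.obj (op X)) (x : N.obj X) : CatTensor M N :=
  (relations M N).mkQ (DirectSum.lof k C (fun X => M.obj (op X) ⊗[k] N.obj X) X (y ⊗ₜ[k] x))

theorem tmul_map (M : Cᵒᵖ ⥤ ModuleCat.{u} k) (N : C ⥤ ModuleCat.{u} k) {X Y : C} (f : X ⟶ Y)
    (y : M.obj (op Y)) (x : N.obj X) :
    tmul M N Y y ((N.map f).hom x) = tmul M N X ((M.map f.op).hom y) x := by
  rw [tmul, tmul, ← sub_eq_zero, ← map_sub]
  exact (Submodule.Quotient.mk_eq_zero _).2 (Submodule.subset_span ⟨X, Y, f, x, y, rfl⟩)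

theorem hom_ext {P : Type*} [AddCommGroup P] [Module k P] {φ ψ : CatTensor M N →ₗ[k] P}
    (h : ∀ X y x, φ (tmul M N X y x) = ψ (tmul M N X y x)) : φ = ψ := by
  classical
  apply Submodule.linearMap_qext
  apply DirectSum.linearMap_ext
  intro X
  apply TensorProduct.ext'
  intro y x
  exact h X y x

open scoped Classical in
/-- A functor `i : E ⥤ C` with maps `M' ⟶ M ∘ i` and `N' ⟶ N ∘ i` induces
`M' ⊗_E N' → M ⊗_C N`, `y ⊗ x ↦ φ y ⊗ ψ x`. -/
noncomputable def mapAlong {E : Type} [SmallCategory E] (i : E ⥤ C)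
    {M' : Eᵒᵖ ⥤ ModuleCat.{u} k} {N' : E ⥤ ModuleCat.{u} k}
    (φ : M' ⟶ i.op ⋙ M) (ψ : N' ⟶ i ⋙ N) : CatTensor M' N' →ₗ[k] CatTensor M N :=
  (relations M' N').liftQ
    (DirectSum.toModule k E _ fun X =>
      (relations M N).mkQ ∘ₗ
        DirectSum.lof k C (fun X => M.obj (op X) ⊗[k] N.obj X) (i.obj X) ∘ₗ
          TensorProduct.map (φ.app (op X)).hom (ψ.app X).hom) (by
    rw [relations, Submodule.span_le]
    rintro _ ⟨X, Y, f, x, y, rfl⟩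
    rw [SetLike.mem_coe, LinearMap.mem_ker, map_sub, sub_eq_zero, DirectSum.toModule_lof,
      DirectSum.toModule_lof]
    have h₁ : (ψ.app Y).hom ((N'.map f).hom x) = (N.map (i.map f)).hom ((ψ.app X).hom x) :=
      congrArg (fun t => t.hom x) (ψ.naturality f)
    have h₂ : (φ.app (op X)).hom ((M'.map f.op).hom y)
        = (M.map (i.map f).op).hom ((φ.app (op Y)).hom y) :=
      congrArg (fun t => t.hom y) (φ.naturality f.op)
    simp only [LinearMap.comp_apply, TensorProduct.map_tmul, h₁, h₂]
    exact tmul_map M N (i.map f) _ _)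

theorem mapAlong_tmul {E : Type} [SmallCategory E] (i : E ⥤ C)
    {M' : Eᵒᵖ ⥤ ModuleCat.{u} k} {N' : E ⥤ ModuleCat.{u} k}
    (φ : M' ⟶ i.op ⋙ M) (ψ : N' ⟶ i ⋙ N) (X : E) (y : M'.obj (op X)) (x : N'.obj X) :
    mapAlong i φ ψ (tmul M' N' X y x)
      = tmul M N (i.obj X) ((φ.app (op X)).hom y) ((ψ.app X).hom x) := by
  classical
  simp only [mapAlong, tmul, Submodule.mkQ_apply, Submodule.liftQ_apply, DirectSum.toModule_lof,
    LinearMap.comp_apply, TensorProduct.map_tmul]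

end CatTensor

/-- The functor `- ⊗_C N : Cᵒᵖ-Mod ⥤ k-Mod`. -/
noncomputable def tensorFunctor (N : C ⥤ ModuleCat.{u} k) :
    (Cᵒᵖ ⥤ ModuleCat.{u} k) ⥤ ModuleCat.{u} k where
  obj M := ModuleCat.of k (CatTensor M N)
  map {M M'} φ := ModuleCat.ofHom
    (CatTensor.mapAlong (𝟭 C) (M := M') (N := N) (M' := M) (N' := N) φ (𝟙 N))
  map_id M := by
    apply ModuleCat.hom_ext
    apply CatTensor.hom_ext
    intro X y x
    exact CatTensor.mapAlong_tmul (𝟭 C) (M := M) (N := N) (M' := M) (N' := N) (𝟙 M) (𝟙 N) X y x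
  map_comp {M M' M''} φ ψ := by
    apply ModuleCat.hom_ext
    apply CatTensor.hom_ext
    intro X y x
    refine (CatTensor.mapAlong_tmul (𝟭 C) (M := M'') (N := N) (M' := M) (N' := N)
      (φ ≫ ψ) (𝟙 N) X y x).trans ?_
    symm
    exact (congrArg (CatTensor.mapAlong (𝟭 C) (M := M'') (N := N) (M' := M') (N' := N) ψ (𝟙 N))
      (CatTensor.mapAlong_tmul (𝟭 C) (M := M') (N := N) (M' := M) (N' := N) φ (𝟙 N) X y x)).trans
      (CatTensor.mapAlong_tmul (𝟭 C) (M := M'') (N := N) (M' := M') (N' := N) ψ (𝟙 N) X _ _)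

theorem CatTensor.tmul_add_left (M : Cᵒᵖ ⥤ ModuleCat.{u} k) (N : C ⥤ ModuleCat.{u} k) (X : C)
    (y y' : M.obj (op X)) (x : N.obj X) :
    tmul M N X (y + y') x = tmul M N X y x + tmul M N X y' x := by
  simp only [tmul, TensorProduct.add_tmul, map_add]

instance (N : C ⥤ ModuleCat.{u} k) : (tensorFunctor N).Additive where
  map_add {M M'} φ ψ := by
    apply ModuleCat.hom_ext
    apply CatTensor.hom_ext
    intro X y x
    refine (CatTensor.mapAlong_tmul (𝟭 C) (M := M') (N := N) (M' := M) (N' := N)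
      (φ + ψ) (𝟙 N) X y x).trans ?_
    refine (CatTensor.tmul_add_left M' N X ((φ.app (op X)).hom y) ((ψ.app (op X)).hom y) x).trans ?_
    symm
    exact congrArg₂ (· + ·)
      (CatTensor.mapAlong_tmul (𝟭 C) (M := M') (N := N) (M' := M) (N' := N) φ (𝟙 N) X y x)
      (CatTensor.mapAlong_tmul (𝟭 C) (M := M') (N := N) (M' := M) (N' := N) ψ (𝟙 N) X y x)

/-- The category of modules over a small category has enough projectives. -/
instance enoughProjectives_functor : EnoughProjectives (Cᵒᵖ ⥤ ModuleCat.{u} k) where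
  presentation F := by
    let L : ∀ X : Cᵒᵖ, ModuleCat.{u} k ⥤ (Cᵒᵖ ⥤ ModuleCat.{u} k) := fun X =>
      evaluationLeftAdjoint (ModuleCat.{u} k) X
    let adj : ∀ X : Cᵒᵖ, L X ⊣ (evaluation _ _).obj X := fun X =>
      evaluationAdjunctionRight (ModuleCat.{u} k) X
    have : ∀ X : Cᵒᵖ, (L X).PreservesProjectiveObjects := fun X =>
      Functor.preservesProjectiveObjects_of_adjunction_of_preservesEpimorphisms (adj X)
    have : ∀ X : Cᵒᵖ, Projective ((L X).obj (Projective.over (F.obj X))) := fun X =>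
      Functor.PreservesProjectiveObjects.projective_obj inferInstance
    let Q : Cᵒᵖ → (Cᵒᵖ ⥤ ModuleCat.{u} k) := fun X => (L X).obj (Projective.over (F.obj X))
    have hQ : ∀ X, Projective (Q X) := this
    let π : ∐ Q ⟶ F :=
      Limits.Sigma.desc fun X => ((adj X).homEquiv _ _).symm (Projective.π (F.obj X))
    have hπ : ∀ X, Epi (π.app X) := by
      intro X
      have h₁ : Limits.Sigma.ι Q X ≫ π
          = ((adj X).homEquiv _ _).symm (Projective.π (F.obj X)) := Limits.Sigma.ι_desc _ _
      have h₂ := ((adj X).homEquiv _ _).apply_symm_apply (Projective.π (F.obj X))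
      rw [← h₁, Adjunction.homEquiv_unit] at h₂
      have h₃ : ((adj X).unit.app (Projective.over (F.obj X)) ≫ (Limits.Sigma.ι Q X).app X) ≫
          π.app X = Projective.π (F.obj X) := by
        rw [Category.assoc]
        exact h₂
      exact epi_of_epi_fac h₃
    have : Epi π := NatTrans.epi_of_epi_app π
    have hP : Projective (∐ Q) := ⟨fun f e _ =>
      ⟨Limits.Sigma.desc fun b => Projective.factorThru (Limits.Sigma.ι Q b ≫ f) e,
        Limits.Sigma.hom_ext _ _ fun b => by
          rw [← Category.assoc, Limits.Sigma.ι_desc, Projective.factorThru_comp]⟩⟩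
    exact ⟨{ p := ∐ Q, projective := hP, f := π, epi := this }⟩

variable (k)

/-- The trivial `Cᵒᵖ`-module, constant with value `k`. -/
noncomputable def trivialModule (C : Type) [SmallCategory C] : Cᵒᵖ ⥤ ModuleCat.{u} k :=
  (Functor.const Cᵒᵖ).obj (ModuleCat.of k k)

/-- The symmetric homology `HS_n(A) = Tor_n^{ΔS}(k, B^{sym}_* A)`: the `n`-th left derived functor
of `- ⊗_{ΔS} B^{sym}_* A`, at the trivial module. -/
noncomputable def symmetricHomology (A : Type u) [Ring A] [Algebra k A] (n : ℕ) : ModuleCat.{u} k :=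
  ((tensorFunctor (symBar k A)).leftDerived n).obj (trivialModule k DeltaS)

/-! ### The standard complexes -/

/-- The free module functor. -/
noncomputable def freeModule : Type ⥤ ModuleCat.{u} k where
  obj S := ModuleCat.of k (S →₀ k)
  map f := ModuleCat.ofHom (Finsupp.lmapDomain k k f)
  map_id S := by
    apply ModuleCat.hom_ext
    exact Finsupp.lmapDomain_id k k
  map_comp f g := by
    apply ModuleCat.hom_ext
    exact Finsupp.lmapDomain_comp k k f g

/-- The simplicial `C`-set `N(- \ C)`, contravariant in `C`. -/
def underNerve (C : Type) [SmallCategory C] : Cᵒᵖ ⥤ SSet.{0} :=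
  Under.mapFunctor C ⋙ nerveFunctor

/-- The simplicial `Cᵒᵖ`-module `k[N(- \ C)]`. -/
noncomputable def underNerveModule (C : Type) [SmallCategory C] :
    SimplicialObject (Cᵒᵖ ⥤ ModuleCat.{u} k) :=
  Functor.flip (underNerve C ⋙
    (SimplicialObject.whiskering Type (ModuleCat.{u} k)).obj (freeModule k))

variable {k}

/-- The simplicial `k`-module `k[N(- \ C)] ⊗_C N`. -/
noncomputable def barTensor (N : C ⥤ ModuleCat.{u} k) : SimplicialObject (ModuleCat.{u} k) :=
  ((SimplicialObject.whiskering _ _).obj (tensorFunctor N)).obj (underNerveModule k C)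

/-- The element `(X → A_0 → ⋯ → A_n) ⊗ x` of `k[N(- \ C)_n] ⊗_C N`. -/
noncomputable def barTensor.chain (N : C ⥤ ModuleCat.{u} k) {n : ℕ} (X : C)
    (c : ComposableArrows (Under X) n) (x : N.obj X) : barTensor N _⦋n⦌ :=
  CatTensor.tmul ((underNerveModule k C).obj (op ⦋n⦌)) N X (Finsupp.single c (1 : k)) x

theorem under_map_post {E : Type} [SmallCategory E] (i : E ⥤ C) {X Y : E} (f : X ⟶ Y) :
    Under.map f ⋙ Under.post i = Under.post i ⋙ Under.map (i.map f) := by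
  have hobj : ∀ Z : Under Y, (Under.map f ⋙ Under.post i).obj Z
      = (Under.post i ⋙ Under.map (i.map f)).obj Z := by
    intro Z
    exact congrArg Under.mk (i.map_comp f Z.hom)
  have hr : ∀ {Z Z' : Under (i.obj X)} (h : Z = Z'), (eqToHom h).right
      = eqToHom (congrArg (fun T : Under (i.obj X) => T.right) h) := by
    rintro Z _ rfl
    rfl
  refine CategoryTheory.Functor.ext hobj (fun Z W g => ?_)
  apply Under.UnderMorphism.ext
  rw [Under.comp_right, Under.comp_right, hr, hr]
  exact ((Category.id_comp _).trans (Category.comp_id _)).symm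

/-- A functor `i : E ⥤ C` maps `N(- \ E)` to `N(- \ C)`, applying `i` to chains. -/
def underNervePost {E : Type} [SmallCategory E] (i : E ⥤ C) :
    underNerve E ⟶ i.op ⋙ underNerve C where
  app X := nerveMap (Under.post (X := X.unop) i)
  naturality _ _ f := congrArg (fun F => nerveMap F) (under_map_post i f.unop)

/-- A functor `i : E ⥤ C` maps `k[N(- \ E)_n]` to `k[N(- \ C)_n]`. -/
noncomputable def underNerveMap {E : Type} [SmallCategory E] (i : E ⥤ C) (Δ : SimplexCategoryᵒᵖ) :
    (underNerveModule k E).obj Δ ⟶ i.op ⋙ (underNerveModule k C).obj Δ where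
  app X := (freeModule k).map (((underNervePost i).app X).app Δ)
  naturality X Y f := by
    have h := congrArg (fun t => (freeModule k).map (NatTrans.app t Δ))
      ((underNervePost i).naturality f)
    exact ((freeModule k).map_comp _ _).symm.trans (h.trans ((freeModule k).map_comp _ _))

theorem underNerveMap_naturality {E : Type} [SmallCategory E] (i : E ⥤ C)
    {Δ Δ' : SimplexCategoryᵒᵖ} (θ : Δ ⟶ Δ') (X : Eᵒᵖ) :
    ((underNerveModule k E).map θ).app X ≫ (underNerveMap i Δ').app X
      = (underNerveMap i Δ).app X ≫ ((underNerveModule k C).map θ).app (i.op.obj X) := by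
  have h := congrArg (fun t => (freeModule k).map t) (((underNervePost i).app X).naturality θ)
  exact ((freeModule k).map_comp _ _).symm.trans (h.trans ((freeModule k).map_comp _ _))

theorem tensorFunctor_map_mapAlong {E : Type} [SmallCategory E] (i : E ⥤ C)
    {N' : E ⥤ ModuleCat.{u} k} {N : C ⥤ ModuleCat.{u} k} (ψ : N' ⟶ i ⋙ N)
    {M₁ M₂ : Eᵒᵖ ⥤ ModuleCat.{u} k} {M₃ M₄ : Cᵒᵖ ⥤ ModuleCat.{u} k}
    (α : M₁ ⟶ M₂) (β : M₃ ⟶ M₄) (φ : M₁ ⟶ i.op ⋙ M₃) (φ' : M₂ ⟶ i.op ⋙ M₄)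
    (h : ∀ X, α.app X ≫ φ'.app X = φ.app X ≫ β.app (i.op.obj X)) :
    (tensorFunctor N').map α ≫ ModuleCat.ofHom (CatTensor.mapAlong i φ' ψ)
      = ModuleCat.ofHom (CatTensor.mapAlong i φ ψ) ≫ (tensorFunctor N).map β := by
  apply ModuleCat.hom_ext
  apply CatTensor.hom_ext
  intro X y x
  refine (congrArg (CatTensor.mapAlong i φ' ψ)
    (CatTensor.mapAlong_tmul (𝟭 E) (M := M₂) (N := N') (M' := M₁) (N' := N') α (𝟙 N') X y x)).trans
    ?_
  refine (CatTensor.mapAlong_tmul i φ' ψ X ((α.app (op X)).hom y) x).trans ?_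
  symm
  refine (congrArg (CatTensor.mapAlong (𝟭 C) (M := M₄) (N := N) (M' := M₃) (N' := N) β (𝟙 N))
    (CatTensor.mapAlong_tmul i φ ψ X y x)).trans ?_
  refine (CatTensor.mapAlong_tmul (𝟭 C) (M := M₄) (N := N) (M' := M₃) (N' := N) β (𝟙 N) (i.obj X)
    ((φ.app (op X)).hom y) ((ψ.app X).hom x)).trans ?_
  exact congrArg (fun z => CatTensor.tmul M₄ N (i.obj X) z ((ψ.app X).hom x))
    (congrArg (fun t => t.hom y) (h (op X))).symm

/-- For a functor `i : E ⥤ C` and `ψ : N' ⟶ N ∘ i`, the simplicial map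
`k[N(- \ E)] ⊗_E N' ⟶ k[N(- \ C)] ⊗_C N` applying `i` to chains and `ψ` to coefficients. -/
noncomputable def barTensor.map {E : Type} [SmallCategory E] (i : E ⥤ C)
    {N' : E ⥤ ModuleCat.{u} k} {N : C ⥤ ModuleCat.{u} k} (ψ : N' ⟶ i ⋙ N) :
    barTensor N' ⟶ barTensor N where
  app Δ := ModuleCat.ofHom (CatTensor.mapAlong i (underNerveMap i Δ) ψ)
  naturality _ _ θ := tensorFunctor_map_mapAlong i ψ _ _ _ _ (underNerveMap_naturality i θ)

/-- For a natural transformation `η` from `F_0 → ⋯ → F_n` to `G_0 → ⋯ → G_n`, the chain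
`F_0 → ⋯ → F_j → G_j → ⋯ → G_n`, with `η_j` in the middle. -/
def prismChain {D : Type} [SmallCategory D] {n : ℕ} {F G : ComposableArrows D n} (η : F ⟶ G)
    (j : Fin (n + 1)) : ComposableArrows D (n + 1) :=
  Functor.prod'
    (Monotone.functor (f := fun i : Fin (n + 2) => if i ≤ j.castSucc then (0 : Fin 2) else 1)
      (by
        intro a b hab
        dsimp only
        split_ifs with h₁ h₂ h₂
        · exact le_rfl
        · exact Fin.zero_le _
        · exact absurd (hab.trans h₂) h₁
        · exact le_rfl))
    (Fin.predAbove_right_monotone j).functor ⋙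
  Functor.uncurry.obj (ComposableArrows.mk₁ η)

end CatTensor

/-! ### The complexes computing symmetric homology -/

section Complexes

variable (k : Type u) [CommRing k] (A : Type u) [Ring A] [Algebra k A]

/-- `Y⁺_* A = k[N(- \ ΔS₊)] ⊗_{ΔS₊} B^{sym₊}_* A`. -/
noncomputable abbrev YPlus : SimplicialObject (ModuleCat.{u} k) := barTensor (symBarPlus k A)

variable {k A}

/-- `Y^{epi}_* A = k[N(- \ Epi ΔS₊)] ⊗_{Epi ΔS₊} B^{sym₊}_* I`. -/
noncomputable abbrev YEpi (ε : A →ₐ[k] k) : SimplicialObject (ModuleCat.{u} k) :=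
  barTensor (symBarIdeal ε)

/-- The inclusion `Y^{epi}_* A ⟶ Y⁺_* A`. -/
noncomputable def YEpi.inclusion (ε : A →ₐ[k] k) : YEpi ε ⟶ YPlus k A :=
  barTensor.map EpiDeltaSPlus.inclusion (symBarIdealInclusion ε)

end Complexes

/-! The unit of `A` is split by `ε`, so `A = k ⊕ I` as a module and `A^{⊗q}` is the direct sum of
the modules `I^{⊗S}` over the subsets `S` of the `q` points. The inclusion of the summand of `S` is
the action of the monomorphism of `Δ₊` with image `S`. Every morphism of `ΔS₊` is an epimorphism
followed by such a monomorphism, uniquely, so the symmetric bar construction of `A` is induced from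
that of `I` along `Epi ΔS₊ ⊂ ΔS₊`: for every `M` the natural map from `M ⊗ B(I)` over `Epi ΔS₊` to
`M ⊗ B(A)` over `ΔS₊` is an isomorphism (`idealComparisonInv_comp`, `idealComparison_comp_inv`).

For `M = k[N(- \ ΔS₊)]` this presents both complexes as tensor products with the same `B(I)` over
`Epi ΔS₊`. It remains to compare the nerves of `X \ Epi ΔS₊` and `X \ ΔS₊`, naturally in `X` along
epimorphisms. Replacing `X → Y` by its image is a functor that retracts the second category onto the
first (`post_comp_imageFunctor`). The inclusions of the images form a natural transformation from
the image functor to the identity, and its prisms are the homotopy `h`. Precomposition with an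
epimorphism does not change images (`map_comp_imageFunctor`), so everything descends to the tensor
product over `Epi ΔS₊`.

For the homology statement, let `j : D ⥤ C` have contractible categories `X ↓ j`. Then `k[N(- ↓ j)]`
resolves the trivial `C`-module by projectives, and its tensor product with `N` is the bar
construction of `j ⋙ N` over `D`, which therefore computes `Tor` over `C` (`tor_iso_barTensor`).
This applies to identities and to `ΔS ⊂ ΔS₊`: adjoining a point gives a zigzag `(X → A) → (X → [0] ⊙
A) ← (X → [0] ⊙ X)`. Hence `HS(A)` is the homology of `Y⁺`, and so of `Y^{epi}`. -/

/-! ### Prisms and simplicial homotopies of nerves. -/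

/-- The monotone map `[n+1] → [1] × [n]` onto the `j`-th maximal chain of the prism. -/
def prismPath {n : ℕ} (j : Fin (n + 1)) : Fin (n + 2) ⥤ Fin 2 × Fin (n + 1) :=
  Functor.prod'
    (Monotone.functor (f := fun i : Fin (n + 2) => if i ≤ j.castSucc then (0 : Fin 2) else 1)
      (by
        intro a b hab
        dsimp only
        split_ifs with h₁ h₂ h₂
        · exact le_rfl
        · exact Fin.zero_le _
        · exact absurd (hab.trans h₂) h₁
        · exact le_rfl))
    (Fin.predAbove_right_monotone j).functor

theorem prismChain_eq {D : Type} [SmallCategory D] {n : ℕ} {F G : ComposableArrows D n} (η : F ⟶ G)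
    (j : Fin (n + 1)) :
    prismChain η j = prismPath j ⋙ Functor.uncurry.obj (ComposableArrows.mk₁ η) := rfl

theorem uncurry_mk₁_whiskerLeft {B C D : Type} [SmallCategory B] [SmallCategory C]
    [SmallCategory D] (c : B ⥤ C) {F G : C ⥤ D} (α : F ⟶ G) :
    Functor.uncurry.obj (ComposableArrows.mk₁ (Functor.whiskerLeft c α)) =
      Functor.prod (𝟭 (Fin 2)) c ⋙ Functor.uncurry.obj (ComposableArrows.mk₁ α) := by
  fapply CategoryTheory.Functor.ext
  · rintro ⟨i, x⟩
    fin_cases i <;> rfl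
  · rintro ⟨i, x⟩ ⟨i', x'⟩ ⟨f, g⟩
    dsimp at f g
    fin_cases i <;> fin_cases i'
    · exact ((Category.id_comp _).trans (Category.comp_id _)).symm
    · exact ((Category.id_comp _).trans (Category.comp_id _)).symm
    · exact absurd (leOfHom f) (by decide)
    · exact ((Category.id_comp _).trans (Category.comp_id _)).symm

theorem uncurry_mk₁_whiskerRight {B C D : Type} [SmallCategory B] [SmallCategory C]
    [SmallCategory D] {F G : B ⥤ C} (α : F ⟶ G) (H : C ⥤ D) :
    Functor.uncurry.obj (ComposableArrows.mk₁ (Functor.whiskerRight α H)) =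
      Functor.uncurry.obj (ComposableArrows.mk₁ α) ⋙ H := by
  fapply CategoryTheory.Functor.ext
  · rintro ⟨i, x⟩
    fin_cases i <;> rfl
  · rintro ⟨i, x⟩ ⟨i', x'⟩ ⟨f, g⟩
    dsimp at f g
    have key : ∀ {a b c : C} (p : a ⟶ b) (q : b ⟶ c),
        H.map p ≫ H.map q = 𝟙 _ ≫ H.map (p ≫ q) ≫ 𝟙 _ := by simp
    fin_cases i <;> fin_cases i'
    · refine Eq.trans ?_ (key (𝟙 (F.obj x)) (F.map g))
      rw [H.map_id]
      rfl
    · exact key (α.app x) (G.map g)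
    · exact absurd (leOfHom f) (by decide)
    · refine Eq.trans ?_ (key (𝟙 (G.obj x)) (G.map g))
      rw [H.map_id]
      rfl

theorem prismChain_whiskerRight {C D : Type} [SmallCategory C] [SmallCategory D] {n : ℕ}
    {F G : ComposableArrows C n} (η : F ⟶ G) (H : C ⥤ D) (j : Fin (n + 1)) :
    prismChain (Functor.whiskerRight η H) j = prismChain η j ⋙ H := by
  rw [prismChain_eq, uncurry_mk₁_whiskerRight]
  rfl

/-- All dependence on `j` sits in the path in the poset `[1] × [n]`; the functor `[1] × B ⥤ C` given
by `α` is fixed. The identities of a simplicial homotopy thus become identities of monotone maps, to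
be checked on vertices. -/
theorem prismChain_whiskerLeft {B C : Type} [SmallCategory B] [SmallCategory C] {n : ℕ}
    (c : ComposableArrows B n) {F G : B ⥤ C} (α : F ⟶ G) (j : Fin (n + 1)) :
    prismChain (Functor.whiskerLeft c α) j =
      (prismPath j ⋙ Functor.prod (𝟭 (Fin 2)) c) ⋙
        Functor.uncurry.obj (ComposableArrows.mk₁ α) := by
  rw [prismChain_eq, uncurry_mk₁_whiskerLeft]
  rfl

instance {m n : ℕ} : Quiver.IsThin (Fin m × Fin n) := fun _ _ =>
  ⟨fun _ _ => Prod.ext (Subsingleton.elim _ _) (Subsingleton.elim _ _)⟩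

theorem functor_ext_of_thin {P Q : Type} [Category P] [Category Q] [Quiver.IsThin Q]
    {F G : P ⥤ Q} (h : ∀ x, F.obj x = G.obj x) : F = G :=
  CategoryTheory.Functor.ext h (fun _ _ _ => Subsingleton.elim _ _)

/-- The functor `[m] ⥤ [n]` of a morphism of the simplex category. -/
abbrev simplexFunctor {m n : ℕ} (θ : ⦋m⦌ ⟶ ⦋n⦌) : Fin (m + 1) ⥤ Fin (n + 1) :=
  (SimplexCategory.toCat.map θ).toFunctor

section

variable {C D : Type} [SmallCategory C] [SmallCategory D] {F G : C ⥤ D} (α : F ⟶ G)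

/-- Serves the identities in which a face or degeneracy `θ` moves past the homotopy operator and
becomes `θ'` on the chain. -/
theorem comp_prismChain_whiskerLeft {m n : ℕ} (c : ComposableArrows C n)
    (θ : Fin (m + 2) ⥤ Fin (n + 2)) (θ' : Fin (m + 1) ⥤ Fin (n + 1)) (j : Fin (n + 1))
    (j' : Fin (m + 1))
    (h : ∀ x, (prismPath j).obj (θ.obj x) =
      (((prismPath j').obj x).1, θ'.obj ((prismPath j').obj x).2)) :
    θ ⋙ prismChain (Functor.whiskerLeft c α) j =
      prismChain (Functor.whiskerLeft (θ' ⋙ c) α) j' := by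
  have hP : θ ⋙ prismPath j = prismPath j' ⋙ Functor.prod (𝟭 (Fin 2)) θ' :=
    functor_ext_of_thin h
  rw [prismChain_whiskerLeft, prismChain_whiskerLeft]
  exact congrArg (fun P => (P ⋙ Functor.prod (𝟭 (Fin 2)) c) ⋙
    Functor.uncurry.obj (ComposableArrows.mk₁ α)) hP

/-- Serves the identity for the common face of two adjacent simplices of the prism: their paths
differ only at the vertex that `θ` omits. -/
theorem comp_prismChain_whiskerLeft_eq {m n : ℕ} (c : ComposableArrows C n)
    (θ : Fin (m + 1) ⥤ Fin (n + 2)) (j j' : Fin (n + 1))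
    (h : ∀ x, (prismPath j).obj (θ.obj x) = (prismPath j').obj (θ.obj x)) :
    θ ⋙ prismChain (Functor.whiskerLeft c α) j =
      θ ⋙ prismChain (Functor.whiskerLeft c α) j' := by
  have hP : θ ⋙ prismPath j = θ ⋙ prismPath j' := functor_ext_of_thin h
  rw [prismChain_whiskerLeft, prismChain_whiskerLeft]
  exact congrArg (fun P => (P ⋙ Functor.prod (𝟭 (Fin 2)) c) ⋙
    Functor.uncurry.obj (ComposableArrows.mk₁ α)) hP

theorem Fin.val_succAbove {n : ℕ} (p : Fin (n + 1)) (i : Fin n) :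
    (p.succAbove i).val = if i.val < p.val then i.val else i.val + 1 := by
  simp only [Fin.succAbove, Fin.lt_def, Fin.val_castSucc]
  split_ifs <;> rfl

theorem Fin.val_predAbove {n : ℕ} (p : Fin n) (i : Fin (n + 1)) :
    (p.predAbove i).val = if p.val < i.val then i.val - 1 else i.val := by
  simp only [Fin.predAbove, Fin.lt_def, Fin.val_castSucc]
  split_ifs <;> rfl

/-- The inclusion of an end of the prism. -/
def prismEnd (n : ℕ) (e : Fin 2) : Fin (n + 1) ⥤ Fin 2 × Fin (n + 1) :=
  Functor.prod' ((Functor.const _).obj e) (𝟭 _)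

theorem prismEnd_uncurry {n : ℕ} (c : ComposableArrows C n) (e : Fin 2) :
    prismEnd n e ⋙ Functor.prod (𝟭 (Fin 2)) c ⋙ Functor.uncurry.obj (ComposableArrows.mk₁ α) =
      c ⋙ (ComposableArrows.mk₁ α).obj e := by
  fapply CategoryTheory.Functor.ext
  · intro x
    rfl
  · intro x y f
    have h : (ComposableArrows.mk₁ α).map (𝟙 e) = 𝟙 _ := (ComposableArrows.mk₁ α).map_id e
    refine Eq.trans ?_ ((Category.id_comp _).trans (Category.comp_id _)).symm
    refine Eq.trans (congrArg (fun t => t.app (c.obj x) ≫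
      ((ComposableArrows.mk₁ α).obj e).map (c.map f)) h) ?_
    exact Category.id_comp _

/-- Serves the two outer faces, where the path without its first or last vertex stays in one end of
the prism. The end `0` carries `F` and the end `1` carries `G`. -/
theorem comp_prismChain_whiskerLeft_end {n : ℕ} (c : ComposableArrows C n)
    (θ : Fin (n + 1) ⥤ Fin (n + 2)) (j : Fin (n + 1)) (e : Fin 2)
    (h : ∀ x, (prismPath j).obj (θ.obj x) = (e, x)) :
    θ ⋙ prismChain (Functor.whiskerLeft c α) j = c ⋙ (ComposableArrows.mk₁ α).obj e := by
  have hP : θ ⋙ prismPath j = prismEnd n e := functor_ext_of_thin h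
  rw [prismChain_whiskerLeft, ← prismEnd_uncurry]
  exact congrArg (fun P => (P ⋙ Functor.prod (𝟭 (Fin 2)) c) ⋙
    Functor.uncurry.obj (ComposableArrows.mk₁ α)) hP

/-- A natural transformation induces a simplicial homotopy of maps of nerves. -/
def nerveHomotopy : SimplicialObject.Homotopy (nerveMap F) (nerveMap G) where
  h j := ↾fun c => prismChain (Functor.whiskerLeft c α) j
  h_zero_comp_δ_zero n := by
    ext c
    refine comp_prismChain_whiskerLeft_end α c (simplexFunctor (SimplexCategory.δ 0)) 0 1
      fun x => ?_
    change ((if (0 : Fin (n + 2)).succAbove x ≤ (0 : Fin (n + 1)).castSucc then (0 : Fin 2) else 1,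
      (0 : Fin (n + 1)).predAbove ((0 : Fin (n + 2)).succAbove x)) : Fin 2 × Fin (n + 1)) = (1, x)
    simp
  h_last_comp_δ_last n := by
    ext c
    refine comp_prismChain_whiskerLeft_end α c
      (simplexFunctor (SimplexCategory.δ (Fin.last (n + 1)))) (Fin.last n) 0 fun x => ?_
    change ((if (Fin.last (n + 1)).succAbove x ≤ (Fin.last n).castSucc then (0 : Fin 2) else 1,
      (Fin.last n).predAbove ((Fin.last (n + 1)).succAbove x)) : Fin 2 × Fin (n + 1)) = (0, x)
    simp [Fin.le_last]
  h_succ_comp_δ_castSucc_of_lt {n} i j hij := by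
    ext c
    refine comp_prismChain_whiskerLeft α c (simplexFunctor (SimplexCategory.δ i.castSucc))
      (simplexFunctor (SimplexCategory.δ i)) j.succ j fun x => ?_
    change ((if i.castSucc.succAbove x ≤ j.succ.castSucc then (0 : Fin 2) else 1,
      j.succ.predAbove (i.castSucc.succAbove x)) : Fin 2 × Fin (n + 2)) =
      (if x ≤ j.castSucc then (0 : Fin 2) else 1, i.succAbove (j.predAbove x))
    -- On underlying natural numbers each identity is linear arithmetic, case by case in the
    -- positions of `x`, `i` and `j`.
    simp only [Fin.le_def, Fin.ext_iff, Prod.mk.injEq, apply_ite Fin.val, Fin.val_succAbove,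
      Fin.val_predAbove, Fin.val_castSucc, Fin.val_succ] at *
    have := x.2
    split_ifs <;> simp <;> omega
  h_succ_comp_δ_castSucc_succ {n} j := by
    ext c
    refine comp_prismChain_whiskerLeft_eq α c
      (simplexFunctor (SimplexCategory.δ j.castSucc.succ)) j.succ j.castSucc fun x => ?_
    change ((if j.castSucc.succ.succAbove x ≤ j.succ.castSucc then (0 : Fin 2) else 1,
      j.succ.predAbove (j.castSucc.succ.succAbove x)) : Fin 2 × Fin (n + 2)) =
      (if j.castSucc.succ.succAbove x ≤ j.castSucc.castSucc then (0 : Fin 2) else 1,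
        j.castSucc.predAbove (j.castSucc.succ.succAbove x))
    simp only [Fin.le_def, Fin.ext_iff, Prod.mk.injEq, apply_ite Fin.val, Fin.val_succAbove,
      Fin.val_predAbove, Fin.val_castSucc, Fin.val_succ] at *
    have := x.2
    split_ifs <;> simp <;> omega
  h_castSucc_comp_δ_succ_of_lt {n} i j hji := by
    ext c
    refine comp_prismChain_whiskerLeft α c (simplexFunctor (SimplexCategory.δ i.succ))
      (simplexFunctor (SimplexCategory.δ i)) j.castSucc j fun x => ?_
    change ((if i.succ.succAbove x ≤ j.castSucc.castSucc then (0 : Fin 2) else 1,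
      j.castSucc.predAbove (i.succ.succAbove x)) : Fin 2 × Fin (n + 2)) =
      (if x ≤ j.castSucc then (0 : Fin 2) else 1, i.succAbove (j.predAbove x))
    simp only [Fin.le_def, Fin.lt_def, Fin.ext_iff, Prod.mk.injEq, apply_ite Fin.val, Fin.val_succAbove,
      Fin.val_predAbove, Fin.val_castSucc, Fin.val_succ] at *
    have := x.2
    split_ifs <;> simp <;> omega
  h_comp_σ_castSucc_of_le {n} i j hij := by
    ext c
    refine comp_prismChain_whiskerLeft α c (simplexFunctor (SimplexCategory.σ i.castSucc))
      (simplexFunctor (SimplexCategory.σ i)) j j.succ fun x => ?_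
    change ((if i.castSucc.predAbove x ≤ j.castSucc then (0 : Fin 2) else 1,
      j.predAbove (i.castSucc.predAbove x)) : Fin 2 × Fin (n + 1)) =
      (if x ≤ j.succ.castSucc then (0 : Fin 2) else 1, i.predAbove (j.succ.predAbove x))
    simp only [Fin.le_def, Fin.ext_iff, Prod.mk.injEq, apply_ite Fin.val,
      Fin.val_predAbove, Fin.val_castSucc, Fin.val_succ] at *
    have := x.2
    split_ifs <;> simp <;> omega
  h_comp_σ_succ_of_lt {n} i j hji := by
    ext c
    refine comp_prismChain_whiskerLeft α c (simplexFunctor (SimplexCategory.σ i.succ))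
      (simplexFunctor (SimplexCategory.σ i)) j j.castSucc fun x => ?_
    change ((if i.succ.predAbove x ≤ j.castSucc then (0 : Fin 2) else 1,
      j.predAbove (i.succ.predAbove x)) : Fin 2 × Fin (n + 1)) =
      (if x ≤ j.castSucc.castSucc then (0 : Fin 2) else 1, i.predAbove (j.castSucc.predAbove x))
    simp only [Fin.le_def, Fin.ext_iff, Prod.mk.injEq, apply_ite Fin.val,
      Fin.val_predAbove, Fin.val_castSucc, Fin.val_succ] at *
    have := x.2
    split_ifs <;> simp <;> omega

end

/-! ### Simplicial modules of chains over a base category. -/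

section

variable (k : Type u) [CommRing k] {E : Type} [SmallCategory E]

/-- The simplicial `Eᵒᵖ`-module of chains in the categories `P(X)`. -/
noncomputable def nerveModule (P : Eᵒᵖ ⥤ Cat.{0, 0}) :
    SimplicialObject (Eᵒᵖ ⥤ ModuleCat.{u} k) :=
  Functor.flip ((P ⋙ nerveFunctor) ⋙
    (SimplicialObject.whiskering Type (ModuleCat.{u} k)).obj (freeModule k))

variable {k}

variable {P Q : Eᵒᵖ ⥤ Cat.{0, 0}}

/-- A natural functor `P(X) ⥤ Q(X)` acts on chains. -/
noncomputable def nerveModule.map (F : P ⟶ Q) : nerveModule k P ⟶ nerveModule k Q :=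
  (flipFunctor _ _ _).map (Functor.whiskerRight (Functor.whiskerRight F nerveFunctor)
    ((SimplicialObject.whiskering Type (ModuleCat.{u} k)).obj (freeModule k)))

theorem nerveModule.map_comp {R : Eᵒᵖ ⥤ Cat.{0, 0}} (F : P ⟶ Q) (G : Q ⟶ R) :
    nerveModule.map (k := k) (F ≫ G) = nerveModule.map F ≫ nerveModule.map G := by
  rw [nerveModule.map, Functor.whiskerRight_comp, Functor.whiskerRight_comp, Functor.map_comp]
  rfl

theorem nerveModule.map_id :
    nerveModule.map (k := k) (𝟙 P) = 𝟙 _ := by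
  rw [nerveModule.map, Functor.whiskerRight_id', Functor.whiskerRight_id']
  exact (flipFunctor _ _ _).map_id _

theorem freeModule_map_comm {S T T' U : Type} {a : S ⟶ T} {b : T ⟶ U} {c : S ⟶ T'} {d : T' ⟶ U}
    (h : a ≫ b = c ≫ d) : (freeModule k).map a ≫ (freeModule k).map b =
      (freeModule k).map c ≫ (freeModule k).map d := by
  rw [← Functor.map_comp, h, Functor.map_comp]

/-- Compatibility of the `α X` is required on prisms and not on the transformations: the functors at
their ends agree only up to a propositional equality, whereas chains can be compared without
transport. -/
theorem nerveHomotopy_natural {F G : P ⟶ Q}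
    (α : ∀ X, (F.app X).toFunctor ⟶ (G.app X).toFunctor)
    (hα : ∀ {X Y : Eᵒᵖ} (f : X ⟶ Y) {n : ℕ} (c : ComposableArrows (P.obj X) n) (j : Fin (n + 1)),
      prismChain (Functor.whiskerLeft c (α X)) j ⋙ (Q.map f).toFunctor =
        prismChain (Functor.whiskerLeft (c ⋙ (P.map f).toFunctor) (α Y)) j)
    {X Y : Eᵒᵖ} (f : X ⟶ Y) {n : ℕ} (j : Fin (n + 1)) :
    (nerveMap (P.map f).toFunctor).app (op ⦋n⦌) ≫ (nerveHomotopy (α Y)).h j =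
      (nerveHomotopy (α X)).h j ≫ (nerveMap (Q.map f).toFunctor).app (op ⦋n + 1⦌) := by
  ext c
  exact (hα f c j).symm

/-- Natural transformations `F_X ⟶ G_X` compatible with the structure maps induce a simplicial
homotopy. -/
noncomputable def nerveModule.homotopy {F G : P ⟶ Q}
    (α : ∀ X, (F.app X).toFunctor ⟶ (G.app X).toFunctor)
    (hα : ∀ {X Y : Eᵒᵖ} (f : X ⟶ Y) {n : ℕ} (c : ComposableArrows (P.obj X) n) (j : Fin (n + 1)),
      prismChain (Functor.whiskerLeft c (α X)) j ⋙ (Q.map f).toFunctor =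
        prismChain (Functor.whiskerLeft (c ⋙ (P.map f).toFunctor) (α Y)) j) :
    SimplicialObject.Homotopy (nerveModule.map (k := k) F) (nerveModule.map G) :=
  { h := fun {n} j =>
      { app := fun X => (freeModule k).map ((nerveHomotopy (α X)).h j)
        naturality := fun X Y f => freeModule_map_comm (nerveHomotopy_natural α hα f j) }
    h_zero_comp_δ_zero := fun n => by
      ext X : 2
      exact ((nerveHomotopy (α X)).whiskerRight (freeModule k)).h_zero_comp_δ_zero n
    h_last_comp_δ_last := fun n => by
      ext X : 2
      exact ((nerveHomotopy (α X)).whiskerRight (freeModule k)).h_last_comp_δ_last n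
    h_succ_comp_δ_castSucc_of_lt := fun i j hij => by
      ext X : 2
      exact ((nerveHomotopy (α X)).whiskerRight (freeModule k)).h_succ_comp_δ_castSucc_of_lt i j hij
    h_succ_comp_δ_castSucc_succ := fun j => by
      ext X : 2
      exact ((nerveHomotopy (α X)).whiskerRight (freeModule k)).h_succ_comp_δ_castSucc_succ j
    h_castSucc_comp_δ_succ_of_lt := fun i j hij => by
      ext X : 2
      exact ((nerveHomotopy (α X)).whiskerRight (freeModule k)).h_castSucc_comp_δ_succ_of_lt i j hij
    h_comp_σ_castSucc_of_le := fun i j hij => by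
      ext X : 2
      exact ((nerveHomotopy (α X)).whiskerRight (freeModule k)).h_comp_σ_castSucc_of_le i j hij
    h_comp_σ_succ_of_lt := fun i j hij => by
      ext X : 2
      exact ((nerveHomotopy (α X)).whiskerRight (freeModule k)).h_comp_σ_succ_of_lt i j hij }

end

/-! ### Contractible categories and resolutions of the trivial module. -/

section Contractible

variable (k : Type u) [CommRing k]

/-- The augmentation of a free module, sending all basis elements to `1`. -/
noncomputable def freeModuleAug : freeModule k ⟶ (Functor.const Type).obj (ModuleCat.of k k) where
  app S := ModuleCat.ofHom (Finsupp.lsum k (fun _ => LinearMap.id) : (S →₀ k) →ₗ[k] k)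
  naturality S T f := by
    apply ModuleCat.hom_ext
    apply Finsupp.lhom_ext
    intro c x
    change (Finsupp.lsum k (fun _ => LinearMap.id) : (T →₀ k) →ₗ[k] k)
      (Finsupp.mapDomain f (Finsupp.single c x)) =
      (Finsupp.lsum k (fun _ => LinearMap.id) : (S →₀ k) →ₗ[k] k) (Finsupp.single c x)
    rw [Finsupp.mapDomain_single]
    simp

theorem freeModuleAug_single {S : Type} (s : S) (r : k) :
    ((freeModuleAug k).app S).hom (Finsupp.single s r) = r := by
  change (Finsupp.lsum k (fun _ => LinearMap.id) : (S →₀ k) →ₗ[k] k) (Finsupp.single s r) = r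
  simp

theorem freeModule_map_single {S T : Type} (f : S ⟶ T) (s : S) (r : k) :
    ((freeModule k).map f).hom (Finsupp.single s r) = Finsupp.single (f s) r :=
  Finsupp.mapDomain_single

/-- The simplicial module of chains of a category. -/
noncomputable abbrev chains (S : Type) [SmallCategory S] : SimplicialObject (ModuleCat.{u} k) :=
  ((SimplicialObject.whiskering Type (ModuleCat.{u} k)).obj (freeModule k)).obj (nerve S)

/-- The augmentation of the chains of a category. -/
noncomputable def chainsAug (S : Type) [SmallCategory S] :
    chains k S ⟶ (SimplicialObject.const (ModuleCat.{u} k)).obj (ModuleCat.of k k) where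
  app _ := (freeModuleAug k).app _
  naturality _ _ _ := (freeModuleAug k).naturality _

/-- The section of the augmentation given by an object. -/
noncomputable def chainsSection {S : Type} [SmallCategory S] (s : S) :
    (SimplicialObject.const (ModuleCat.{u} k)).obj (ModuleCat.of k k) ⟶ chains k S where
  app Δ := ModuleCat.ofHom (Finsupp.lsingle ((Functor.const _).obj s))
  naturality Δ Δ' θ := by
    apply ModuleCat.hom_ext
    apply LinearMap.ext
    intro r
    exact (freeModule_map_single k ((nerve S).map θ) ((Functor.const _).obj s) r).symm

theorem chainsSection_comp_aug {S : Type} [SmallCategory S] (s : S) :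
    chainsSection k s ≫ chainsAug k S = 𝟙 _ := by
  ext Δ : 2
  apply LinearMap.ext
  intro r
  exact freeModuleAug_single k _ r

/-- Identifies the composite as induced by a functor, so that natural transformations can connect it
to the identity. -/
theorem chainsAug_comp_section {S : Type} [SmallCategory S] (s : S) :
    chainsAug k S ≫ chainsSection k s =
      ((SimplicialObject.whiskering Type (ModuleCat.{u} k)).obj (freeModule k)).map
        (nerveMap ((Functor.const S).obj s)) := by
  ext Δ : 2
  apply Finsupp.lhom_ext
  intro c r
  refine (congrArg (fun t => (Finsupp.single ((Functor.const _).obj s) t :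
    ComposableArrows S _ →₀ k)) (freeModuleAug_single k _ r)).trans ?_
  exact (freeModule_map_single k ((nerveMap ((Functor.const S).obj s)).app Δ) c r).symm

/-- A zigzag of natural transformations from the identity to a constant functor contracts the
complex of chains. -/
noncomputable def chainsHomotopyEquiv {S : Type} [SmallCategory S] (s : S) (F : S ⥤ S)
    (α : 𝟭 S ⟶ F) (β : (Functor.const S).obj s ⟶ F) :
    HomotopyEquiv ((AlgebraicTopology.alternatingFaceMapComplex (ModuleCat.{u} k)).obj (chains k S))
      ((AlgebraicTopology.alternatingFaceMapComplex (ModuleCat.{u} k)).obj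
        ((SimplicialObject.const (ModuleCat.{u} k)).obj (ModuleCat.of k k))) where
  hom := (AlgebraicTopology.alternatingFaceMapComplex _).map (chainsAug k S)
  inv := (AlgebraicTopology.alternatingFaceMapComplex _).map (chainsSection k s)
  homotopyHomInvId :=
    -- `β` joins the constant functor to `F`, and `α` read backwards joins `F` to the identity.
    (Homotopy.ofEq (by rw [← Functor.map_comp, chainsAug_comp_section])).trans
      ((((nerveHomotopy β).whiskerRight (freeModule k)).toChainHomotopy).trans
        ((((nerveHomotopy α).whiskerRight (freeModule k)).toChainHomotopy).symm.trans
          (Homotopy.ofEq ((congrArg (AlgebraicTopology.alternatingFaceMapComplex _).map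
            (((SimplicialObject.whiskering Type (ModuleCat.{u} k)).obj (freeModule k)).map_id
              (nerve S))).trans
            ((AlgebraicTopology.alternatingFaceMapComplex _).map_id _)))))
  homotopyInvHomId := Homotopy.ofEq (by
    rw [← Functor.map_comp, chainsSection_comp_aug, CategoryTheory.Functor.map_id])

/-- A category with a zigzag of natural transformations from its identity to a constant functor. -/
def IsConicallyContractible (S : Type) [SmallCategory S] : Prop :=
  ∃ (s : S) (F : S ⥤ S), Nonempty (𝟭 S ⟶ F) ∧ Nonempty ((Functor.const S).obj s ⟶ F)

variable {E : Type} [SmallCategory E]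

/-- The augmentation of `k[N(P(-))]`. -/
noncomputable def nerveModuleAug (P : Eᵒᵖ ⥤ Cat.{0, 0}) :
    nerveModule k P ⟶ (SimplicialObject.const (Eᵒᵖ ⥤ ModuleCat.{u} k)).obj (trivialModule k E) where
  app Δ :=
    { app := fun X => (freeModuleAug k).app _
      naturality := fun X Y f => (freeModuleAug k).naturality _ }
  naturality Δ Δ' θ := by
    ext X : 2
    exact (freeModuleAug k).naturality _

/-- The contractions of the `P(X)` need not be natural in `X`, because a quasi-isomorphism of
complexes of functors is detected objectwise. -/
theorem quasiIso_nerveModuleAug (P : Eᵒᵖ ⥤ Cat.{0, 0})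
    (hP : ∀ X, IsConicallyContractible (P.obj X)) :
    QuasiIso ((AlgebraicTopology.alternatingFaceMapComplex _).map (nerveModuleAug k P)) := by
  rw [HomologicalComplex.quasiIso_iff_evaluation]
  intro X
  obtain ⟨s, F, ⟨α⟩, ⟨β⟩⟩ := hP X
  have h : QuasiIso ((AlgebraicTopology.alternatingFaceMapComplex (ModuleCat.{u} k)).map
      (chainsAug k (P.obj X))) :=
    (chainsHomotopyEquiv k s F α β).quasiIso_hom
  have h' : QuasiIso (((SimplicialObject.whiskering _ _).obj
      ((evaluation Eᵒᵖ (ModuleCat.{u} k)).obj X) ⋙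
        AlgebraicTopology.alternatingFaceMapComplex _).map (nerveModuleAug k P)) := h
  rw [← AlgebraicTopology.map_alternatingFaceMapComplex] at h'
  exact h'

/-- The complex of a constant simplicial object is concentrated in degree `0` up to homotopy. -/
noncomputable def constHomotopyEquiv {B : Type*} [Category B] [Abelian B] (Z : B) :
    HomotopyEquiv ((AlgebraicTopology.alternatingFaceMapComplex B).obj
      ((SimplicialObject.const B).obj Z)) ((ChainComplex.single₀ B).obj Z) :=
  (SimplicialObject.Augmented.ExtraDegeneracy.const Z).homotopyEquiv

/-- The resolution of the trivial module by chains. -/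
noncomputable def nerveModuleResolution (P : Eᵒᵖ ⥤ Cat.{0, 0})
    (hP : ∀ X, IsConicallyContractible (P.obj X))
    (hproj : ∀ n : ℕ, Projective ((nerveModule k P).obj (op ⦋n⦌))) :
    ProjectiveResolution (trivialModule k E) where
  complex := (AlgebraicTopology.alternatingFaceMapComplex _).obj (nerveModule k P)
  projective := hproj
  π := (AlgebraicTopology.alternatingFaceMapComplex _).map (nerveModuleAug k P) ≫
    (constHomotopyEquiv (trivialModule k E)).hom
  quasiIso := by
    have := quasiIso_nerveModuleAug k P hP
    infer_instance

/-- `Tor` of the trivial module via the resolution by chains. -/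
noncomputable def torIsoNerveModule (P : Eᵒᵖ ⥤ Cat.{0, 0})
    (hP : ∀ X, IsConicallyContractible (P.obj X))
    (hproj : ∀ n : ℕ, Projective ((nerveModule k P).obj (op ⦋n⦌)))
    (N : E ⥤ ModuleCat.{u} k) (n : ℕ) :
    ((tensorFunctor N).leftDerived n).obj (trivialModule k E) ≅
      ((AlgebraicTopology.alternatingFaceMapComplex (ModuleCat.{u} k)).obj
        (((SimplicialObject.whiskering _ _).obj (tensorFunctor N)).obj
          (nerveModule k P))).homology n :=
  (nerveModuleResolution k P hP hproj).isoLeftDerivedObj (tensorFunctor N) n ≪≫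
    (HomologicalComplex.homologyFunctor _ _ n).mapIso
      (eqToIso (Functor.congr_obj
        (AlgebraicTopology.map_alternatingFaceMapComplex (tensorFunctor N)) (nerveModule k P)))

end Contractible

/-! ### The categories `X ↓ j`, and projectivity of their modules of chains. -/

section

variable {C D : Type} [SmallCategory C] [SmallCategory D] (j : D ⥤ C)

theorem structuredArrow_hom_heq {X : C} {Z W Z' W' : StructuredArrow X j} (hZ : Z = Z')
    (hW : W = W') {f : Z ⟶ W} {f' : Z' ⟶ W'} (h : HEq f.right f'.right) : HEq f f' := by
  cases hZ
  cases hW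
  exact heq_of_eq (StructuredArrow.hom_ext _ _ (eq_of_heq h))

/-- A morphism under `X` is determined by its right component. The functors compared below change
objects only by a propositional equality of structure maps, and there the condition on morphisms
usually holds by `HEq.rfl`. -/
theorem structuredArrow_functor_ext {B : Type} [Category B] {X : C}
    {F G : B ⥤ StructuredArrow X j} (hobj : ∀ b, F.obj b = G.obj b)
    (hmap : ∀ {b b' : B} (f : b ⟶ b'), HEq (F.map f).right (G.map f).right) : F = G :=
  CategoryTheory.Functor.hext hobj fun _ _ f =>
    structuredArrow_hom_heq j (hobj _) (hobj _) (hmap f)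

/-- The categories `X ↓ j`, contravariantly in `X`. -/
def structuredArrowFunctor : Cᵒᵖ ⥤ Cat.{0, 0} where
  obj X := Cat.of (StructuredArrow X.unop j)
  map f := (StructuredArrow.map f.unop).toCatHom
  map_id X := Cat.ext (structuredArrow_functor_ext (B := StructuredArrow X.unop j) j
    (fun Z => congrArg StructuredArrow.mk (Category.id_comp Z.hom)) (fun _ => HEq.rfl))
  map_comp {X _ _} f g := Cat.ext (structuredArrow_functor_ext (B := StructuredArrow X.unop j) j
    (fun Z => congrArg StructuredArrow.mk (Category.assoc g.unop f.unop Z.hom))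
    (fun _ => HEq.rfl))

/-- A chain `A_0 → ⋯ → A_n` seen under `A_0`. -/
def chainUnder {n : ℕ} (d : ComposableArrows D n) :
    ComposableArrows (StructuredArrow (j.obj (d.obj 0)) j) n where
  obj i := StructuredArrow.mk (j.map (d.map (homOfLE (Fin.zero_le i))))
  map f := StructuredArrow.homMk (d.map f) (by
    dsimp
    rw [← j.map_comp, ← d.map_comp]
    rfl)

/-- A chain `X → jA_0 → ⋯ → jA_n` is the pullback along `X → jA_0` of the universal chain, the one
that starts with the identity of `jA_0`. So `k[N(- ↓ j)_n]` is a sum of representables `k[Hom(-,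
jA_0)]`, one for each chain of `D`. -/
theorem chainUnder_map {n : ℕ} {X : C} (c : ComposableArrows (StructuredArrow X j) n) :
    chainUnder j (c ⋙ StructuredArrow.proj X j) ⋙ StructuredArrow.map (c.obj 0).hom = c :=
  structuredArrow_functor_ext j
    (fun i => congrArg StructuredArrow.mk (StructuredArrow.w (c.map (homOfLE (Fin.zero_le i)))))
    (fun _ => HEq.rfl)

variable (k : Type u) [CommRing k]

theorem nerveModule_map_single (P : Cᵒᵖ ⥤ Cat.{0, 0}) {n : ℕ} {X Y : Cᵒᵖ} (f : X ⟶ Y)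
    (c : ComposableArrows (P.obj X) n) (r : k) :
    (((nerveModule k P).obj (op ⦋n⦌)).map f).hom (Finsupp.single c r) =
      Finsupp.single (c ⋙ (P.map f).toFunctor) r :=
  freeModule_map_single k _ _ _

/-- The generator of `k[N(jA_0 ↓ j)]` given by a chain. -/
noncomputable def chainGenerator {n : ℕ} (d : ComposableArrows D n) :
    ((nerveModule k (structuredArrowFunctor j)).obj (op ⦋n⦌)).obj (op (j.obj (d.obj 0))) :=
  (Finsupp.single (chainUnder j d) (1 : k) : _ →₀ k)

theorem chainGenerator_map {n : ℕ} {X : C} (c : ComposableArrows (StructuredArrow X j) n) :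
    (((nerveModule k (structuredArrowFunctor j)).obj (op ⦋n⦌)).map (c.obj 0).hom.op).hom
      (chainGenerator j k (c ⋙ StructuredArrow.proj X j)) =
        (Finsupp.single c (1 : k) : _ →₀ k) :=
  (nerveModule_map_single k (structuredArrowFunctor j) (c.obj 0).hom.op _ 1).trans
    (congrArg (fun t => (Finsupp.single t (1 : k) : _ →₀ k)) (chainUnder_map j c))

variable {k}

/-- The morphism from `k[N(- ↓ j)_n]` with prescribed values on chains. -/
noncomputable def structuredArrowModuleDesc {n : ℕ} (M : Cᵒᵖ ⥤ ModuleCat.{u} k)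
    (a : ∀ d : ComposableArrows D n, M.obj (op (j.obj (d.obj 0)))) :
    (nerveModule k (structuredArrowFunctor j)).obj (op ⦋n⦌) ⟶ M where
  app X := ModuleCat.ofHom (Finsupp.linearCombination k
    (fun c : ComposableArrows (StructuredArrow X.unop j) n =>
      (M.map (c.obj 0).hom.op).hom (a (c ⋙ StructuredArrow.proj X.unop j))))
  naturality X Y f := by
    apply ModuleCat.hom_ext
    apply Finsupp.lhom_ext
    intro c r
    refine (congrArg (Finsupp.linearCombination k
      (fun c : ComposableArrows (StructuredArrow Y.unop j) n =>
        (M.map (c.obj 0).hom.op).hom (a (c ⋙ StructuredArrow.proj Y.unop j))))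
      (nerveModule_map_single k (structuredArrowFunctor j) f c r)).trans ?_
    refine (Finsupp.linearCombination_single _ _ _).trans ?_
    symm
    refine (congrArg (M.map f).hom (Finsupp.linearCombination_single _ _ _)).trans ?_
    rw [map_smul]
    congr 1
    have h : M.map (c.obj 0).hom.op ≫ M.map f = M.map (f.unop ≫ (c.obj 0).hom).op := by
      rw [← M.map_comp]
      rfl
    exact congrArg (fun t => t.hom (a (c ⋙ StructuredArrow.proj X.unop j))) h

theorem structuredArrowModule_hom_ext {n : ℕ} {M : Cᵒᵖ ⥤ ModuleCat.{u} k}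
    {f g : (nerveModule k (structuredArrowFunctor j)).obj (op ⦋n⦌) ⟶ M}
    (h : ∀ d, (f.app _).hom (chainGenerator j k d) = (g.app _).hom (chainGenerator j k d)) :
    f = g := by
  ext X : 2
  apply ModuleCat.hom_ext
  apply Finsupp.lhom_ext'
  intro c
  apply LinearMap.ext_ring
  have hf : ∀ f : (nerveModule k (structuredArrowFunctor j)).obj (op ⦋n⦌) ⟶ M,
      (f.app X).hom (Finsupp.single c (1 : k) : _ →₀ k) = (M.map (c.obj 0).hom.op).hom
        ((f.app _).hom (chainGenerator j k (c ⋙ StructuredArrow.proj X.unop j))) := by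
    intro f
    refine (congrArg (f.app X).hom (chainGenerator_map j k c).symm).trans ?_
    exact congrArg (fun t => t.hom (chainGenerator j k (c ⋙ StructuredArrow.proj X.unop j)))
      (f.naturality (c.obj 0).hom.op)
  exact (hf f).trans ((congrArg (M.map (c.obj 0).hom.op).hom
    (h (c ⋙ StructuredArrow.proj X.unop j))).trans (hf g).symm)

theorem structuredArrowModuleDesc_generator {n : ℕ} (M : Cᵒᵖ ⥤ ModuleCat.{u} k)
    (a : ∀ d : ComposableArrows D n, M.obj (op (j.obj (d.obj 0)))) (d : ComposableArrows D n) :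
    ((structuredArrowModuleDesc j M a).app _).hom (chainGenerator j k d) = a d := by
  refine (Finsupp.linearCombination_single _ _ _).trans ?_
  rw [one_smul]
  have h : ((chainUnder j d).obj 0).hom = 𝟙 _ := by
    change j.map (d.map (𝟙 0)) = _
    rw [d.map_id, j.map_id]
  change (M.map ((chainUnder j d).obj 0).hom.op).hom (a d) = a d
  rw [h]
  exact congrArg (fun t => t.hom (a d)) (M.map_id _)

/-- The module is free on the universal chains, so a map out of it lifts through an epimorphism,
which is objectwise surjective, by lifting the value on each generator. -/
instance projective_structuredArrowModule (n : ℕ) :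
    Projective ((nerveModule k (structuredArrowFunctor j)).obj (op ⦋n⦌)) where
  factors {M B} f e he := by
    have hs : ∀ X, Function.Surjective (e.app X).hom := fun X =>
      (ModuleCat.epi_iff_surjective _).1 ((NatTrans.epi_iff_epi_app e).1 he X)
    choose a ha using fun d : ComposableArrows D n =>
      hs _ ((f.app _).hom (chainGenerator j k d))
    refine ⟨structuredArrowModuleDesc j M a, structuredArrowModule_hom_ext j fun d => ?_⟩
    exact (congrArg (e.app _).hom (structuredArrowModuleDesc_generator j M a d)).trans (ha d)

end

/-! ### Universal property of the tensor product over a category. -/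

namespace CatTensor

variable {k : Type u} [CommRing k] {C : Type} [SmallCategory C]
variable {M : Cᵒᵖ ⥤ ModuleCat.{u} k} {N : C ⥤ ModuleCat.{u} k}

open scoped Classical in
/-- Balanced families of bilinear maps induce linear maps on `M ⊗_C N`. -/
noncomputable def lift {P : Type u} [AddCommGroup P] [Module k P]
    (B : ∀ X : C, M.obj (op X) →ₗ[k] N.obj X →ₗ[k] P)
    (hB : ∀ {X Y : C} (f : X ⟶ Y) (y : M.obj (op Y)) (x : N.obj X),
      B Y y ((N.map f).hom x) = B X ((M.map f.op).hom y) x) : CatTensor M N →ₗ[k] P :=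
  (relations M N).liftQ (DirectSum.toModule k C _ fun X => TensorProduct.lift (B X)) (by
    rw [relations, Submodule.span_le]
    rintro _ ⟨X, Y, f, x, y, rfl⟩
    rw [SetLike.mem_coe, LinearMap.mem_ker, map_sub, sub_eq_zero, DirectSum.toModule_lof,
      DirectSum.toModule_lof]
    exact hB f y x)

theorem lift_tmul {P : Type u} [AddCommGroup P] [Module k P]
    (B : ∀ X : C, M.obj (op X) →ₗ[k] N.obj X →ₗ[k] P)
    (hB : ∀ {X Y : C} (f : X ⟶ Y) (y : M.obj (op Y)) (x : N.obj X),
      B Y y ((N.map f).hom x) = B X ((M.map f.op).hom y) x) (X : C) (y : M.obj (op X))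
    (x : N.obj X) : lift B hB (tmul M N X y x) = B X y x := by
  classical
  simp only [lift, tmul, Submodule.mkQ_apply, Submodule.liftQ_apply, DirectSum.toModule_lof,
    TensorProduct.lift.tmul]

open scoped Classical in
variable (M N) in
/-- `tmul` as a bilinear map. -/
noncomputable def tmulBilin (X : C) : M.obj (op X) →ₗ[k] N.obj X →ₗ[k] CatTensor M N :=
  (TensorProduct.mk k (M.obj (op X)) (N.obj X)).compr₂
    ((relations M N).mkQ ∘ₗ DirectSum.lof k C (fun X => M.obj (op X) ⊗[k] N.obj X) X)

theorem hom_ext_bilin {P : Type*} [AddCommGroup P] [Module k P] {φ ψ : CatTensor M N →ₗ[k] P}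
    (h : ∀ X, (tmulBilin M N X).compr₂ φ = (tmulBilin M N X).compr₂ ψ) : φ = ψ :=
  hom_ext fun X y x => congrArg (fun t => t y x) (h X)

end CatTensor

/-! ### Bar constructions computing `Tor` over another category. -/

section

variable {k : Type u} [CommRing k] {C E : Type} [SmallCategory C] [SmallCategory E]

/-- `R ⊗_C N` for a simplicial module `R`. -/
noncomputable abbrev simplicialTensor (N : C ⥤ ModuleCat.{u} k)
    (R : SimplicialObject (Cᵒᵖ ⥤ ModuleCat.{u} k)) : SimplicialObject (ModuleCat.{u} k) :=
  ((SimplicialObject.whiskering _ _).obj (tensorFunctor N)).obj R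

/-- Restriction of simplicial modules along `i`. -/
noncomputable abbrev simplicialRestrict (i : E ⥤ C)
    (R : SimplicialObject (Cᵒᵖ ⥤ ModuleCat.{u} k)) : SimplicialObject (Eᵒᵖ ⥤ ModuleCat.{u} k) :=
  ((SimplicialObject.whiskering _ _).obj ((Functor.whiskeringLeft _ _ _).obj i.op)).obj R

/-- The simplicial map `R' ⊗_E N' ⟶ R ⊗_C N` along a functor `i`. -/
noncomputable def simplicialMapAlong (i : E ⥤ C)
    {N' : E ⥤ ModuleCat.{u} k} {N : C ⥤ ModuleCat.{u} k} (ψ : N' ⟶ i ⋙ N)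
    {R' : SimplicialObject (Eᵒᵖ ⥤ ModuleCat.{u} k)} {R : SimplicialObject (Cᵒᵖ ⥤ ModuleCat.{u} k)}
    (φ : R' ⟶ simplicialRestrict i R) : simplicialTensor N' R' ⟶ simplicialTensor N R where
  app Δ := ModuleCat.ofHom (CatTensor.mapAlong i (φ.app Δ) ψ)
  naturality _ _ θ := tensorFunctor_map_mapAlong i ψ _ _ _ _
    (fun X => congrArg (fun t => NatTrans.app t X) (φ.naturality θ))

variable (j : E ⥤ C)

/-- The functor `X ↓ E ⥤ jX ↓ j`. -/
def underToStructuredArrow (X : E) : Under X ⥤ StructuredArrow (j.obj X) j where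
  obj Z := StructuredArrow.mk (j.map Z.hom)
  map f := StructuredArrow.homMk f.right (by
    dsimp
    rw [← j.map_comp, Under.w])

/-- The functors `X ↓ E ⥤ jX ↓ j` are natural. -/
def underToStructuredArrowNat : Under.mapFunctor E ⟶ j.op ⋙ structuredArrowFunctor j where
  app X := (underToStructuredArrow j X.unop).toCatHom
  naturality X _ f := Cat.ext (structuredArrow_functor_ext (B := Under X.unop) j
    (fun Z => congrArg StructuredArrow.mk (j.map_comp f.unop Z.hom)) (fun _ => HEq.rfl))

/-- A chain `A_0 → ⋯ → A_n` seen under `A_0`. -/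
def chainUnder' {n : ℕ} (d : ComposableArrows E n) : ComposableArrows (Under (d.obj 0)) n :=
  chainUnder (𝟭 E) d

/-- The comparison `k[N(- \ E)] ⊗_E jN ⟶ k[N(- ↓ j)] ⊗_C N`. -/
noncomputable def barTensorToStructuredArrow (N : C ⥤ ModuleCat.{u} k) :
    barTensor (j ⋙ N) ⟶ simplicialTensor N (nerveModule k (structuredArrowFunctor j)) :=
  simplicialMapAlong j (𝟙 (j ⋙ N)) (nerveModule.map (underToStructuredArrowNat j))

theorem underToStructuredArrow_chainUnder {n : ℕ} {X : C}
    (c : ComposableArrows (StructuredArrow X j) n) :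
    chainUnder' (c ⋙ StructuredArrow.proj X j) ⋙ underToStructuredArrow j _ =
      chainUnder j (c ⋙ StructuredArrow.proj X j) :=
  structuredArrow_functor_ext j (fun _ => rfl) (fun _ => HEq.rfl)

theorem chainUnder'_map {n : ℕ} {X : E} (c : ComposableArrows (Under X) n) :
    chainUnder' (c ⋙ Under.forget X) ⋙ Under.map (c.obj 0).hom = c :=
  chainUnder_map (𝟭 E) c

/-- The bilinear map inducing the inverse of the comparison. -/
noncomputable def structuredArrowBilin (N : C ⥤ ModuleCat.{u} k) (n : ℕ) (X : C) :
    ((nerveModule k (structuredArrowFunctor j)).obj (op ⦋n⦌)).obj (op X) →ₗ[k] N.obj X →ₗ[k]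
      CatTensor ((underNerveModule k E).obj (op ⦋n⦌)) (j ⋙ N) :=
  Finsupp.lsum k fun c : ComposableArrows (StructuredArrow X j) n =>
    LinearMap.toSpanSingleton k _
      ((CatTensor.tmulBilin ((underNerveModule k E).obj (op ⦋n⦌)) (j ⋙ N) (c.obj 0).right
        (Finsupp.single (chainUnder' (c ⋙ StructuredArrow.proj X j)) (1 : k))) ∘ₗ
        (N.map (c.obj 0).hom).hom)

theorem structuredArrowBilin_single (N : C ⥤ ModuleCat.{u} k) {n : ℕ} {X : C}
    (c : ComposableArrows (StructuredArrow X j) n) (x : N.obj X) :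
    structuredArrowBilin j N n X (Finsupp.single c (1 : k) : _ →₀ k) x =
      CatTensor.tmul ((underNerveModule k E).obj (op ⦋n⦌)) (j ⋙ N) (c.obj 0).right
        (Finsupp.single (chainUnder' (c ⋙ StructuredArrow.proj X j)) (1 : k))
        ((N.map (c.obj 0).hom).hom x) := by
  refine (congrArg (fun t : N.obj X →ₗ[k] CatTensor _ _ => t x)
    (Finsupp.lsum_single k _ c (1 : k))).trans ?_
  rw [LinearMap.toSpanSingleton_apply, one_smul]
  rfl

theorem nerveModule_linearMap_ext {P : Cᵒᵖ ⥤ Cat.{0, 0}} {n : ℕ} {X : Cᵒᵖ} {V : Type*}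
    [AddCommGroup V] [Module k V]
    {φ ψ : ((nerveModule k P).obj (op ⦋n⦌)).obj X →ₗ[k] V}
    (h : ∀ c : ComposableArrows (P.obj X) n,
      φ (Finsupp.single c (1 : k) : _ →₀ k) = ψ (Finsupp.single c (1 : k) : _ →₀ k)) : φ = ψ :=
  Finsupp.lhom_ext' (M := k) (φ := φ) (ψ := ψ) fun c => LinearMap.ext_ring (h c)

/-- Precomposition with `f` alters only the first arrow `Y → jA_0` of a chain, and that arrow enters
solely through its action on `N`. Balancedness is then functoriality of `N`. -/
theorem structuredArrowBilin_balanced (N : C ⥤ ModuleCat.{u} k) (n : ℕ) {X Y : C} (f : X ⟶ Y)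
    (y : ((nerveModule k (structuredArrowFunctor j)).obj (op ⦋n⦌)).obj (op Y)) (x : N.obj X) :
    structuredArrowBilin j N n Y y ((N.map f).hom x) = structuredArrowBilin j N n X
      ((((nerveModule k (structuredArrowFunctor j)).obj (op ⦋n⦌)).map f.op).hom y) x := by
  refine congrArg (fun t => t y) (nerveModule_linearMap_ext
    (φ := (structuredArrowBilin j N n Y).flip ((N.map f).hom x))
    (ψ := (structuredArrowBilin j N n X).flip x ∘ₗ
      (((nerveModule k (structuredArrowFunctor j)).obj (op ⦋n⦌)).map f.op).hom) fun c => ?_)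
  refine (structuredArrowBilin_single j N c _).trans ?_
  refine Eq.trans ?_ (congrArg (fun t => structuredArrowBilin j N n X t x)
    (nerveModule_map_single k (structuredArrowFunctor j) f.op c 1)).symm
  refine Eq.trans ?_ (structuredArrowBilin_single j N (c ⋙ StructuredArrow.map f) x).symm
  exact congrArg (CatTensor.tmul ((underNerveModule k E).obj (op ⦋n⦌)) (j ⋙ N) (c.obj 0).right
    (Finsupp.single (chainUnder' (c ⋙ StructuredArrow.proj Y j)) (1 : k)))
    (congrArg (fun t => t.hom x) (N.map_comp f (c.obj 0).hom)).symm

/-- The inverse of the comparison, in degree `n`. -/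
noncomputable def barTensorOfStructuredArrow (N : C ⥤ ModuleCat.{u} k) (n : ℕ) :
    CatTensor ((nerveModule k (structuredArrowFunctor j)).obj (op ⦋n⦌)) N →ₗ[k]
      CatTensor ((underNerveModule k E).obj (op ⦋n⦌)) (j ⋙ N) :=
  CatTensor.lift (structuredArrowBilin j N n) (structuredArrowBilin_balanced j N n)

theorem barTensorOfStructuredArrow_tmul (N : C ⥤ ModuleCat.{u} k) {n : ℕ} {X : C}
    (c : ComposableArrows (StructuredArrow X j) n) (x : N.obj X) :
    barTensorOfStructuredArrow j N n
      (CatTensor.tmul _ _ X (Finsupp.single c (1 : k) : _ →₀ k) x) =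
      CatTensor.tmul ((underNerveModule k E).obj (op ⦋n⦌)) (j ⋙ N) (c.obj 0).right
        (Finsupp.single (chainUnder' (c ⋙ StructuredArrow.proj X j)) (1 : k))
        ((N.map (c.obj 0).hom).hom x) :=
  (CatTensor.lift_tmul _ _ X _ x).trans (structuredArrowBilin_single j N c x)

theorem barTensorToStructuredArrow_tmul (N : C ⥤ ModuleCat.{u} k) {n : ℕ} {X : E}
    (c : ComposableArrows (Under X) n) (x : N.obj (j.obj X)) :
    ((barTensorToStructuredArrow j N).app (op ⦋n⦌)).hom
      (CatTensor.tmul ((underNerveModule k E).obj (op ⦋n⦌)) (j ⋙ N) X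
        (Finsupp.single c (1 : k)) x) =
      CatTensor.tmul ((nerveModule k (structuredArrowFunctor j)).obj (op ⦋n⦌)) N (j.obj X)
        (Finsupp.single (c ⋙ underToStructuredArrow j X) (1 : k) : _ →₀ k) x :=
  (CatTensor.mapAlong_tmul j _ (𝟙 (j ⋙ N)) X _ x).trans
    (congrArg (fun t => CatTensor.tmul
      ((nerveModule k (structuredArrowFunctor j)).obj (op ⦋n⦌)) N (j.obj X) t x)
      (freeModule_map_single k _ c 1))

/-- In `k[N(- ↓ j)] ⊗_C N` the arrow `u : X → jA_0` can be moved from the chain to the coefficient: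
`(X → jA_0 → ⋯) ⊗ x` equals the universal chain under `jA_0` tensored with `N(u) x`, which comes
from `E`. -/
theorem isIso_barTensorToStructuredArrow (N : C ⥤ ModuleCat.{u} k) :
    IsIso (barTensorToStructuredArrow (k := k) j N) := by
  refine NatTrans.isIso_iff_isIso_app _ |>.2 fun Δ => ?_
  induction Δ using Opposite.rec with | _ Δ
  induction Δ using SimplexCategory.rec with | _ n
  refine ⟨ModuleCat.ofHom (barTensorOfStructuredArrow j N n), ?_, ?_⟩
  · apply ModuleCat.hom_ext
    refine CatTensor.hom_ext_bilin fun X => nerveModule_linearMap_ext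
      (P := Under.mapFunctor E) fun c => LinearMap.ext fun x => ?_
    refine (congrArg (barTensorOfStructuredArrow j N n)
      (barTensorToStructuredArrow_tmul j N c x)).trans ?_
    refine (barTensorOfStructuredArrow_tmul j N (c ⋙ underToStructuredArrow j X) x).trans ?_
    -- Here the first arrow lies in `E`, so it can be moved back from the coefficient into the
    -- chain.
    refine (CatTensor.tmul_map ((underNerveModule k E).obj (op ⦋n⦌)) (j ⋙ N)
      (c.obj 0).hom _ x).trans ?_
    refine congrArg (fun t => CatTensor.tmul ((underNerveModule k E).obj (op ⦋n⦌)) (j ⋙ N) X t x)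
      ((nerveModule_map_single k (Under.mapFunctor E) (c.obj 0).hom.op _ 1).trans ?_)
    exact congrArg (fun t => (Finsupp.single t (1 : k) : _ →₀ k)) (chainUnder'_map c)
  · apply ModuleCat.hom_ext
    refine CatTensor.hom_ext_bilin fun X => nerveModule_linearMap_ext
      (P := structuredArrowFunctor j) fun c => LinearMap.ext fun x => ?_
    refine (congrArg ((barTensorToStructuredArrow j N).app (op ⦋n⦌)).hom
      (barTensorOfStructuredArrow_tmul j N c x)).trans ?_
    refine (barTensorToStructuredArrow_tmul j N _ _).trans ?_
    refine (CatTensor.tmul_map ((nerveModule k (structuredArrowFunctor j)).obj (op ⦋n⦌)) N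
      (c.obj 0).hom _ x).trans ?_
    refine congrArg (fun t => CatTensor.tmul
      ((nerveModule k (structuredArrowFunctor j)).obj (op ⦋n⦌)) N X t x)
      (Eq.trans ?_ (chainGenerator_map j k c))
    exact congrArg (((nerveModule k (structuredArrowFunctor j)).obj (op ⦋n⦌)).map
      (c.obj 0).hom.op).hom (congrArg (fun t => (Finsupp.single t (1 : k) : _ →₀ k))
        (underToStructuredArrow_chainUnder j c))

/-- If the categories `X ↓ j` are contractible, then the bar construction of `j ⋙ N` over `E`
computes `Tor` over `C`. -/
theorem tor_iso_barTensor (hj : ∀ X : C, IsConicallyContractible (StructuredArrow X j))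
    (N : C ⥤ ModuleCat.{u} k) (n : ℕ) :
    Nonempty (((tensorFunctor N).leftDerived n).obj (trivialModule k C) ≅
      ((AlgebraicTopology.alternatingFaceMapComplex (ModuleCat.{u} k)).obj
        (barTensor (j ⋙ N))).homology n) := by
  have := isIso_barTensorToStructuredArrow (k := k) j N
  exact ⟨torIsoNerveModule k (structuredArrowFunctor j) (fun X => hj X.unop)
    (projective_structuredArrowModule j) N n ≪≫
    (HomologicalComplex.homologyFunctor _ _ n).mapIso
      ((AlgebraicTopology.alternatingFaceMapComplex (ModuleCat.{u} k)).mapIso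
        (asIso (barTensorToStructuredArrow j N)).symm)⟩

/-- The identity of `X` is an initial object, so the zigzag degenerates to a single transformation.
-/
theorem isConicallyContractible_structuredArrow_id (X : C) :
    IsConicallyContractible (StructuredArrow X (𝟭 C)) :=
  ⟨StructuredArrow.mk (𝟙 X), 𝟭 _, ⟨𝟙 _⟩,
    ⟨{ app := fun Z => StructuredArrow.homMk Z.hom (Category.id_comp _)
       naturality := fun _ _ f => StructuredArrow.hom_ext _ _
        ((Category.id_comp _).trans (StructuredArrow.w f).symm) }⟩⟩

/-- The bar construction of `N` computes `Tor(k, N)`. -/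
theorem tor_iso_barTensor_self (N : C ⥤ ModuleCat.{u} k) (n : ℕ) :
    Nonempty (((tensorFunctor N).leftDerived n).obj (trivialModule k C) ≅
      ((AlgebraicTopology.alternatingFaceMapComplex (ModuleCat.{u} k)).obj
        (barTensor N)).homology n) :=
  tor_iso_barTensor (𝟭 C) isConicallyContractible_structuredArrow_id N n

end

/-! ### Adjoining a point: from `ΔS` to `ΔS₊`. -/

namespace TensorMor

/-- `x_0 ⊗ f`, with the variables of `f` shifted. -/
def addPoint {p q : ℕ} (f : TensorMor p q) : TensorMor (p + 1) (q + 1) where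
  word := Fin.cons [0] fun i => (f.word i).map Fin.succ
  count_eq_one j := by
    rw [Fin.sum_univ_succ]
    simp only [Fin.cons_zero, Fin.cons_succ]
    induction j using Fin.cases with
    | zero =>
      rw [Finset.sum_eq_zero]
      · simp
      · intro i _
        rw [List.count_eq_zero]
        simp
    | succ j =>
      simp only [List.count_map_of_injective _ _ (Fin.succ_injective p), f.count_eq_one]
      simp [(Fin.succ_ne_zero j).symm]

/-- `1 ⊗ x_0 ⊗ ⋯ ⊗ x_{p-1}`. -/
def unitLeft (p : ℕ) : TensorMor p (p + 1) where
  word := Fin.cons [] fun i => [i]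
  count_eq_one j := by
    rw [Fin.sum_univ_succ]
    simp only [Fin.cons_zero, Fin.cons_succ]
    have := (TensorMor.id p).count_eq_one j
    simpa [TensorMor.id] using this

theorem addPoint_id (p : ℕ) : (TensorMor.id p).addPoint = TensorMor.id (p + 1) := by
  ext i : 2
  induction i using Fin.cases <;> simp [addPoint, TensorMor.id]

theorem addPoint_comp {p q r : ℕ} (f : TensorMor p q) (g : TensorMor q r) :
    (f.comp g).addPoint = f.addPoint.comp g.addPoint := by
  ext i : 2
  induction i using Fin.cases <;>
    simp [addPoint, TensorMor.comp, List.flatMap_map, List.map_flatMap]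

theorem comp_unitLeft {p q : ℕ} (f : TensorMor p q) :
    f.comp (unitLeft q) = (unitLeft p).comp f.addPoint := by
  ext i : 2
  induction i using Fin.cases <;> simp [addPoint, unitLeft, TensorMor.comp, List.flatMap_map]

end TensorMor

/-- The endofunctor `[0] ⊙ -` of `ΔS`. -/
def DeltaS.addPoint : DeltaS ⥤ DeltaS where
  obj X := ⟨X.dim + 1⟩
  map f := TensorMor.addPoint f
  map_id X := TensorMor.addPoint_id (X.dim + 1)
  map_comp f g := TensorMor.addPoint_comp f g

/-- The inclusion `A ⟶ [0] ⊙ A`. -/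
def DeltaS.unitLeft : 𝟭 DeltaS ⟶ DeltaS.addPoint where
  app X := TensorMor.unitLeft (X.dim + 1)
  naturality _ _ f := TensorMor.comp_unitLeft f

/-- The endofunctor `(X → A) ↦ (X → A → [0] ⊙ A)`. -/
def structuredArrowAddPoint (X : DeltaSPlus) :
    StructuredArrow X DeltaS.inclusion ⥤ StructuredArrow X DeltaS.inclusion where
  obj Z := StructuredArrow.mk (Z.hom ≫ DeltaS.inclusion.map (DeltaS.unitLeft.app Z.right))
  map {Z W} f := StructuredArrow.homMk (DeltaS.addPoint.map f.right) (by
    have h := DeltaS.unitLeft.naturality f.right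
    have h' := congrArg DeltaS.inclusion.map h
    rw [Functor.map_comp, Functor.map_comp] at h'
    have hw : Z.hom ≫ DeltaS.inclusion.map f.right = W.hom := StructuredArrow.w f
    change (Z.hom ≫ DeltaS.inclusion.map (DeltaS.unitLeft.app Z.right)) ≫
      DeltaS.inclusion.map (DeltaS.addPoint.map f.right) =
        W.hom ≫ DeltaS.inclusion.map (DeltaS.unitLeft.app W.right)
    rw [Category.assoc, ← h', ← hw, Category.assoc]
    rfl)
  map_id Z := StructuredArrow.hom_ext _ _ (DeltaS.addPoint.map_id Z.right)
  map_comp f g := StructuredArrow.hom_ext _ _ (DeltaS.addPoint.map_comp f.right g.right)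

/-- The zigzag at `f : X → A` is `A → [0] ⊙ A ← [0] ⊙ X`, with right leg `[0] ⊙ f`; both legs are
under `X` by naturality of the inclusion `A → [0] ⊙ A`. -/
theorem isConicallyContractible_structuredArrow_inclusion (X : DeltaSPlus) :
    IsConicallyContractible (StructuredArrow X DeltaS.inclusion) :=
  -- An object of `ΔS` with `dim = X.card` has `X.card + 1` points. This is `[0] ⊙ X`, which is
  -- nonempty even when `X` is `[-1]`.
  ⟨StructuredArrow.mk (S := X) (T := DeltaS.inclusion) (Y := DeltaS.mk X.card)
      (TensorMor.unitLeft X.card), structuredArrowAddPoint X,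
    ⟨{ app := fun Z => StructuredArrow.homMk (DeltaS.unitLeft.app Z.right) rfl
       naturality := fun _ _ f => StructuredArrow.hom_ext _ _
        (DeltaS.unitLeft.naturality f.right) }⟩,
    ⟨{ app := fun Z => StructuredArrow.homMk (TensorMor.addPoint Z.hom)
        (TensorMor.comp_unitLeft Z.hom).symm
       naturality := fun Z W f => StructuredArrow.hom_ext _ _ (by
        have hw : Z.hom ≫ DeltaS.inclusion.map f.right = W.hom := StructuredArrow.w f
        refine (Category.id_comp _).trans ?_
        exact (congrArg TensorMor.addPoint hw).symm.trans
          (TensorMor.addPoint_comp Z.hom (DeltaS.inclusion.map f.right))) }⟩⟩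

/-- Symmetric homology is computed by the bar construction over `ΔS₊`. -/
theorem symmetricHomology_iso_YPlus (k : Type u) [CommRing k] (A : Type u) [Ring A] [Algebra k A]
    (n : ℕ) : Nonempty (symmetricHomology k A n ≅
      ((AlgebraicTopology.alternatingFaceMapComplex (ModuleCat.{u} k)).obj
        (YPlus k A)).homology n) := by
  obtain ⟨e₁⟩ := tor_iso_barTensor_self (symBar k A) n
  obtain ⟨e₂⟩ := tor_iso_barTensor DeltaS.inclusion
    isConicallyContractible_structuredArrow_inclusion (symBarPlus k A) n
  obtain ⟨e₃⟩ := tor_iso_barTensor_self (symBarPlus k A) n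
  -- `symBar` is by definition the restriction of `symBarPlus`, so `e₁` and `e₂` end in the same bar
  -- construction over `ΔS`.
  exact ⟨e₁ ≪≫ e₂.symm ≪≫ e₃⟩

/-! ### Factorization into an epimorphism and a monomorphism of `Δ₊`. -/

namespace TensorMor

theorem eq_of_mem_word {p q : ℕ} (f : TensorMor p q) {j : Fin p} {i i' : Fin q}
    (h : j ∈ f.word i) (h' : j ∈ f.word i') : i = i' := by
  by_contra hne
  have h1 := Finset.add_le_sum (f := fun i => (f.word i).count j) (s := Finset.univ)
    (fun _ _ => Nat.zero_le _) (Finset.mem_univ i) (Finset.mem_univ i') hne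
  rw [f.count_eq_one] at h1
  have := List.count_pos_iff.2 h
  have := List.count_pos_iff.2 h'
  omega

/-- The monomials of `f` are nonempty and share no variables, so the first variable after
substitution reveals the first letter, which can then be cancelled. This is why morphisms without
empty monomials are epimorphisms. -/
theorem flatMap_word_injective {p q : ℕ} (f : TensorMor p q) (hf : ∀ i, f.word i ≠ [])
    (l l' : List (Fin q)) (h : l.flatMap f.word = l'.flatMap f.word) : l = l' := by
  induction l generalizing l' with
  | nil =>
    cases l' with
    | nil => rfl
    | cons b l' => simp [hf b] at h
  | cons a l ih =>
    cases l' with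
    | nil => simp [hf a] at h
    | cons b l' =>
      rw [List.flatMap_cons, List.flatMap_cons] at h
      have hab : a = b := by
        obtain ⟨x, s, hx⟩ := List.exists_cons_of_ne_nil (hf a)
        obtain ⟨y, t, hy⟩ := List.exists_cons_of_ne_nil (hf b)
        have hxy : x = y := by
          rw [hx, hy, List.cons_append, List.cons_append] at h
          exact (List.cons.inj h).1
        exact f.eq_of_mem_word (j := x) (by simp [hx]) (by simp [hy, hxy])
      subst hab
      rw [ih l' (List.append_cancel_left h)]

/-- The image of the set map underlying a morphism. -/
def image {p q : ℕ} (f : TensorMor p q) : Finset (Fin q) :=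
  Finset.univ.filter fun i => f.word i ≠ []

theorem mem_image {p q : ℕ} (f : TensorMor p q) (i : Fin q) : i ∈ f.image ↔ f.word i ≠ [] := by
  simp [image]

/-- The morphism of `Δ₊` of an order embedding. -/
def ofEmb {r q : ℕ} (e : Fin r ↪o Fin q) : TensorMor r q where
  word i := (List.finRange r).filter fun a => e a = i
  count_eq_one a := by
    rw [Finset.sum_eq_single (e a)]
    · rw [List.count_filter (by simp)]
      exact List.count_eq_one_of_mem (List.nodup_finRange r) (List.mem_finRange a)
    · intro i _ hi
      rw [List.count_eq_zero]
      simp [hi.symm]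
    · simp

theorem ofEmb_word_apply {r q : ℕ} (e : Fin r ↪o Fin q) (a : Fin r) :
    (ofEmb e).word (e a) = [a] := by
  have h : (ofEmb e).word (e a) = (List.finRange r).filter fun b => b = a := by
    simp [ofEmb]
  rw [h, List.filter_eq, List.count_eq_one_of_mem (List.nodup_finRange r) (List.mem_finRange a)]
  rfl

theorem ofEmb_word_eq_nil {r q : ℕ} (e : Fin r ↪o Fin q) {i : Fin q} (hi : i ∉ Set.range e) :
    (ofEmb e).word i = [] := by
  simp only [ofEmb, List.filter_eq_nil_iff]
  intro a _ ha
  exact hi ⟨a, by simpa using ha⟩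

theorem comp_ofEmb_word_apply {p r q : ℕ} (g : TensorMor p r) (e : Fin r ↪o Fin q) (a : Fin r) :
    (g.comp (ofEmb e)).word (e a) = g.word a := by
  simp [TensorMor.comp, ofEmb_word_apply]

theorem comp_ofEmb_injective {p r q : ℕ} (e : Fin r ↪o Fin q) {g g' : TensorMor p r}
    (h : g.comp (ofEmb e) = g'.comp (ofEmb e)) : g = g' := by
  ext a : 2
  rw [← comp_ofEmb_word_apply g e, h, comp_ofEmb_word_apply]

/-- The restriction of the target of a morphism whose image lies in the range of `e`. -/
def restrict {p r q : ℕ} (f : TensorMor p q) (e : Fin r ↪o Fin q)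
    (h : ∀ i ∈ f.image, i ∈ Set.range e) : TensorMor p r where
  word a := f.word (e a)
  count_eq_one j := by
    rw [← f.count_eq_one j]
    refine (Finset.sum_map Finset.univ e.toEmbedding
      (fun i => (f.word i).count j)).symm.trans ?_
    apply Finset.sum_subset (Finset.subset_univ _)
    intro i _ hi
    have : f.word i = [] := by
      by_contra hne
      obtain ⟨a, ha⟩ := h i ((f.mem_image i).2 hne)
      exact hi (Finset.mem_map.2 ⟨a, Finset.mem_univ _, ha⟩)
    simp [this]

theorem restrict_comp_ofEmb {p r q : ℕ} (f : TensorMor p q) (e : Fin r ↪o Fin q)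
    (h : ∀ i ∈ f.image, i ∈ Set.range e) : (f.restrict e h).comp (ofEmb e) = f := by
  ext i : 2
  by_cases hi : i ∈ Set.range e
  · obtain ⟨a, rfl⟩ := hi
    rw [comp_ofEmb_word_apply]
    rfl
  · have h1 : f.word i = [] := by
      by_contra hne
      exact hi (h i ((f.mem_image i).2 hne))
    simp [TensorMor.comp, ofEmb_word_eq_nil e hi, h1]

theorem image_comp_subset {p q r : ℕ} (f : TensorMor p q) (g : TensorMor q r) {i : Fin r}
    (hi : i ∈ (f.comp g).image) : i ∈ g.image := by
  rw [mem_image] at hi ⊢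
  intro h
  exact hi (by simp [TensorMor.comp, h])

/-- Substituting nonempty monomials into a nonempty monomial cannot give the empty one. Naturality
of images along epimorphisms rests on this. -/
theorem image_comp_of_ne_nil {p q r : ℕ} (f : TensorMor p q) (hf : ∀ i, f.word i ≠ [])
    (g : TensorMor q r) : (f.comp g).image = g.image := by
  ext i
  refine ⟨f.image_comp_subset g, fun hi => ?_⟩
  rw [mem_image] at hi ⊢
  intro h
  obtain ⟨a, s, ha⟩ := List.exists_cons_of_ne_nil hi
  have h' : f.word a ++ s.flatMap f.word = [] := by
    simpa [TensorMor.comp, ha] using h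
  exact hf a (List.append_eq_nil_iff.1 h').1

theorem image_eq_univ {p q : ℕ} (f : TensorMor p q) (hf : ∀ i, f.word i ≠ []) :
    f.image = Finset.univ := by
  ext i
  simp [mem_image, hf i]

/-- The order embedding of the image of a morphism. -/
def imageEmb {p q : ℕ} (f : TensorMor p q) : Fin f.image.card ↪o Fin q :=
  f.image.orderEmbOfFin rfl

theorem range_imageEmb {p q : ℕ} (f : TensorMor p q) : Set.range f.imageEmb = f.image :=
  f.image.range_orderEmbOfFin rfl

/-- Factor `f` through its image. The first factor has no empty monomials, so discarding it does not
change the image of the composite with `g`. -/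
theorem image_ofEmb_comp {p q q' r r' : ℕ} {f : TensorMor p q} {f' : TensorMor p q'}
    (g : TensorMor q q') (hg : f.comp g = f') (e : Fin r ↪o Fin q) (e' : Fin r' ↪o Fin q')
    (he : Set.range e = f.image) (he' : Set.range e' = f'.image) :
    ∀ i ∈ ((ofEmb e).comp g).image, i ∈ Set.range e' := by
  intro i hi
  rw [he', Finset.mem_coe, ← hg, ← f.restrict_comp_ofEmb e (by simp [he])]
  have h : ((f.restrict e (by simp [he])).comp (ofEmb e)).comp g =
      (f.restrict e (by simp [he])).comp ((ofEmb e).comp g) := by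
    ext i : 2
    simp [TensorMor.comp, List.flatMap_assoc]
  rw [h, image_comp_of_ne_nil]
  · exact hi
  · intro a
    change f.word (e a) ≠ []
    rw [← mem_image, ← Finset.mem_coe, ← he]
    exact ⟨a, rfl⟩

/-- The concatenated word is strictly increasing, since `e` reflects the order, and it contains
every variable. A strictly increasing list is determined by its set of entries. -/
theorem flatten_ofFn_ofEmb {r q : ℕ} (e : Fin r ↪o Fin q) :
    (List.ofFn (ofEmb e).word).flatten = List.finRange r := by
  have hp : (List.ofFn (ofEmb e).word).flatten.Pairwise (· < ·) := by
    rw [List.pairwise_flatten]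
    constructor
    · intro l hl
      obtain ⟨i, rfl⟩ := List.mem_ofFn.1 hl
      exact (List.pairwise_lt_finRange r).filter _
    · rw [List.pairwise_ofFn]
      intro i i' hi a ha b hb
      simp only [ofEmb, List.mem_filter, decide_eq_true_eq] at ha hb
      rw [← e.lt_iff_lt, ha.2, hb.2]
      exact hi
  refine List.Perm.eq_of_pairwise (fun a b _ _ h h' => absurd h (lt_asymm h')) hp
    (List.pairwise_lt_finRange r) ?_
  rw [List.perm_ext_iff_of_nodup hp.nodup (List.nodup_finRange r)]
  intro a
  simp only [List.mem_finRange, iff_true, List.mem_flatten, List.mem_ofFn]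
  exact ⟨_, ⟨e a, rfl⟩, by simp [ofEmb_word_apply]⟩

end TensorMor

/-- The range determines both the size of the source and the embedding. This makes factorizations
unique on the nose, so that the functor identities below are equalities and not mere isomorphisms.
-/
theorem emb_eq_of_range {r r' q : ℕ} (e : Fin r ↪o Fin q) (e' : Fin r' ↪o Fin q)
    (h : Set.range e = Set.range e') : ∃ hr : r = r', hr ▸ e = e' := by
  have hr : r = r' := by
    have h1 := Set.ncard_range_of_injective e.injective
    have h2 := Set.ncard_range_of_injective e'.injective
    rw [h, h2] at h1
    simpa using h1.symm
  subst hr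
  exact ⟨rfl, (OrderEmbedding.range_inj).1 h⟩

theorem DeltaSPlus.epi_iff_word_ne_nil {X Y : DeltaSPlus} (f : X ⟶ Y) :
    Epi f ↔ ∀ i, TensorMor.word f i ≠ [] := by
  refine ⟨fun _ => DeltaSPlus.word_ne_nil_of_epi f, fun h => ⟨fun {Z} u v huv => ?_⟩⟩
  apply TensorMor.ext
  funext i
  exact TensorMor.flatMap_word_injective f h _ _
    (congrFun (congrArg TensorMor.word huv) i)

/-- The morphism of `ΔS₊` given by an order embedding. -/
def DeltaSPlus.ofEmb {r : ℕ} {Y : DeltaSPlus} (e : Fin r ↪o Fin Y.card) : DeltaSPlus.mk r ⟶ Y :=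
  TensorMor.ofEmb e

instance {r : ℕ} {Y : DeltaSPlus} (e : Fin r ↪o Fin Y.card) : Mono (DeltaSPlus.ofEmb e) where
  right_cancellation _ _ h := TensorMor.comp_ofEmb_injective e h

theorem DeltaSPlus.isOrdered_ofEmb {r : ℕ} {Y : DeltaSPlus} (e : Fin r ↪o Fin Y.card) :
    DeltaSPlus.IsOrdered (DeltaSPlus.ofEmb e) :=
  TensorMor.flatten_ofFn_ofEmb e

section

variable {X Y Y' : DeltaSPlus}

/-- The corestriction of a morphism along an order embedding onto its image. -/
def DeltaSPlus.corestrict (f : X ⟶ Y) {r : ℕ} (e : Fin r ↪o Fin Y.card)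
    (he : Set.range e = TensorMor.image f) : X ⟶ DeltaSPlus.mk r :=
  TensorMor.restrict f e (by simp [he])

instance DeltaSPlus.epi_corestrict (f : X ⟶ Y) {r : ℕ} (e : Fin r ↪o Fin Y.card)
    (he : Set.range e = TensorMor.image f) : Epi (DeltaSPlus.corestrict f e he) := by
  rw [DeltaSPlus.epi_iff_word_ne_nil]
  intro a
  change TensorMor.word f (e a) ≠ []
  rw [← TensorMor.mem_image, ← Finset.mem_coe, ← he]
  exact ⟨a, rfl⟩

theorem DeltaSPlus.corestrict_comp_ofEmb (f : X ⟶ Y) {r : ℕ} (e : Fin r ↪o Fin Y.card)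
    (he : Set.range e = TensorMor.image f) :
    DeltaSPlus.corestrict f e he ≫ DeltaSPlus.ofEmb e = f :=
  TensorMor.restrict_comp_ofEmb f e (by simp [he])

/-- The morphism between the images of `f` and `f ≫ g` induced by `g`. -/
def DeltaSPlus.imageMap {f : X ⟶ Y} {f' : X ⟶ Y'} (g : Y ⟶ Y') (hg : f ≫ g = f') {r r' : ℕ}
    (e : Fin r ↪o Fin Y.card) (e' : Fin r' ↪o Fin Y'.card)
    (he : Set.range e = TensorMor.image f) (he' : Set.range e' = TensorMor.image f') :
    DeltaSPlus.mk r ⟶ DeltaSPlus.mk r' :=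
  TensorMor.restrict ((TensorMor.ofEmb e).comp g) e' (TensorMor.image_ofEmb_comp g hg e e' he he')

theorem DeltaSPlus.imageMap_comp_ofEmb {f : X ⟶ Y} {f' : X ⟶ Y'} (g : Y ⟶ Y') (hg : f ≫ g = f')
    {r r' : ℕ} (e : Fin r ↪o Fin Y.card) (e' : Fin r' ↪o Fin Y'.card)
    (he : Set.range e = TensorMor.image f) (he' : Set.range e' = TensorMor.image f') :
    DeltaSPlus.imageMap g hg e e' he he' ≫ DeltaSPlus.ofEmb e' = DeltaSPlus.ofEmb e ≫ g :=
  TensorMor.restrict_comp_ofEmb _ e' _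

theorem DeltaSPlus.corestrict_comp_imageMap {f : X ⟶ Y} {f' : X ⟶ Y'} (g : Y ⟶ Y')
    (hg : f ≫ g = f') {r r' : ℕ} (e : Fin r ↪o Fin Y.card) (e' : Fin r' ↪o Fin Y'.card)
    (he : Set.range e = TensorMor.image f) (he' : Set.range e' = TensorMor.image f') :
    DeltaSPlus.corestrict f e he ≫ DeltaSPlus.imageMap g hg e e' he he' =
      DeltaSPlus.corestrict f' e' he' := by
  rw [← cancel_mono (DeltaSPlus.ofEmb e'), Category.assoc, DeltaSPlus.imageMap_comp_ofEmb,
    DeltaSPlus.corestrict_comp_ofEmb, ← Category.assoc, DeltaSPlus.corestrict_comp_ofEmb, hg]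

theorem DeltaSPlus.epi_imageMap {f : X ⟶ Y} {f' : X ⟶ Y'} (g : Y ⟶ Y')
    (hg : f ≫ g = f') {r r' : ℕ} (e : Fin r ↪o Fin Y.card) (e' : Fin r' ↪o Fin Y'.card)
    (he : Set.range e = TensorMor.image f) (he' : Set.range e' = TensorMor.image f') :
    Epi (DeltaSPlus.imageMap g hg e e' he he') :=
  epi_of_epi_fac (DeltaSPlus.corestrict_comp_imageMap g hg e e' he he')

end

/-! ### The image functor and its naturality along epimorphisms. -/

namespace EpiDeltaSPlus

/-- The epimorphism onto the image of a morphism. -/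
def underImage {X : EpiDeltaSPlus} {Y : DeltaSPlus} (f : X.obj ⟶ Y) {r : ℕ}
    (e : Fin r ↪o Fin Y.card) (he : Set.range e = TensorMor.image f) : Under X :=
  Under.mk (Y := (⟨DeltaSPlus.mk r⟩ : EpiDeltaSPlus))
    ⟨DeltaSPlus.corestrict f e he, DeltaSPlus.epi_corestrict f e he⟩

/-- The morphism between images, under the source. -/
def underImageMap {X : EpiDeltaSPlus} {Y Y' : DeltaSPlus} {f : X.obj ⟶ Y} {f' : X.obj ⟶ Y'}
    (g : Y ⟶ Y') (hg : f ≫ g = f') {r r' : ℕ} (e : Fin r ↪o Fin Y.card) (e' : Fin r' ↪o Fin Y'.card)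
    (he : Set.range e = TensorMor.image f) (he' : Set.range e' = TensorMor.image f') :
    underImage f e he ⟶ underImage f' e' he' :=
  Under.homMk ⟨DeltaSPlus.imageMap g hg e e' he he', DeltaSPlus.epi_imageMap g hg e e' he he'⟩
    (WideSubcategory.hom_ext _ (DeltaSPlus.corestrict_comp_imageMap g hg e e' he he'))

/-- The morphism between the images of two objects under `X`. -/
def imageFunctorMap {X : EpiDeltaSPlus} {Z W : Under X.obj} (g : Z ⟶ W) :
    underImage Z.hom (TensorMor.imageEmb Z.hom) (TensorMor.range_imageEmb Z.hom) ⟶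
      underImage W.hom (TensorMor.imageEmb W.hom) (TensorMor.range_imageEmb W.hom) :=
  underImageMap g.right (Under.w g) _ _ _ _

/-- The right-hand embedding is a monomorphism, so this square characterizes the map between images.
Functoriality follows by pasting squares. -/
theorem imageFunctorMap_comp {X : EpiDeltaSPlus} {Z W : Under X.obj} (g : Z ⟶ W) :
    (imageFunctorMap g).right.hom ≫ DeltaSPlus.ofEmb (TensorMor.imageEmb W.hom) =
      DeltaSPlus.ofEmb (TensorMor.imageEmb Z.hom) ≫ g.right :=
  DeltaSPlus.imageMap_comp_ofEmb g.right (Under.w g) _ _ (TensorMor.range_imageEmb Z.hom)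
    (TensorMor.range_imageEmb W.hom)

/-- The image functor from objects under `X` in `ΔS₊` to objects under `X` in `Epi ΔS₊`. -/
def imageFunctor (X : EpiDeltaSPlus) : Under X.obj ⥤ Under X where
  obj Z := underImage Z.hom (TensorMor.imageEmb Z.hom) (TensorMor.range_imageEmb Z.hom)
  map g := imageFunctorMap g
  map_id Z := by
    apply Under.UnderMorphism.ext
    apply WideSubcategory.hom_ext
    refine (cancel_mono (DeltaSPlus.ofEmb (TensorMor.imageEmb Z.hom))).1 ?_
    refine (imageFunctorMap_comp (𝟙 Z)).trans ?_
    exact (Category.comp_id _).trans (Category.id_comp _).symm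
  map_comp {Z W V} g h := by
    apply Under.UnderMorphism.ext
    apply WideSubcategory.hom_ext
    refine (cancel_mono (DeltaSPlus.ofEmb (TensorMor.imageEmb V.hom))).1 ?_
    refine (imageFunctorMap_comp (g ≫ h)).trans ?_
    exact (CommSq.horiz_comp (CommSq.mk (imageFunctorMap_comp g))
      (CommSq.mk (imageFunctorMap_comp h))).w.symm

/-- The inclusion of the image. -/
def imageInclusion (X : EpiDeltaSPlus) :
    imageFunctor X ⋙ Under.post EpiDeltaSPlus.inclusion ⟶ 𝟭 (Under X.obj) where
  app Z := Under.homMk (DeltaSPlus.ofEmb (TensorMor.imageEmb Z.hom))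
    (DeltaSPlus.corestrict_comp_ofEmb _ _ (TensorMor.range_imageEmb Z.hom))
  naturality _ _ g := by
    apply Under.UnderMorphism.ext
    exact imageFunctorMap_comp g

/-- Arbitrary embeddings with the right range are allowed, not only `imageEmb`, so that an equality
of cardinalities of images can be eliminated by substitution. -/
theorem underImage_congr {X : EpiDeltaSPlus} {Y : DeltaSPlus} (f : X.obj ⟶ Y) {r r' : ℕ}
    (e : Fin r ↪o Fin Y.card) (e' : Fin r' ↪o Fin Y.card) (he : Set.range e = TensorMor.image f)
    (he' : Set.range e' = TensorMor.image f) : underImage f e he = underImage f e' he' := by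
  obtain ⟨rfl, rfl⟩ := emb_eq_of_range e e' (he.trans he'.symm)
  rfl

theorem ofEmb_heq {Y : DeltaSPlus} {r r' : ℕ}
    (e : Fin r ↪o Fin Y.card) (e' : Fin r' ↪o Fin Y.card) (he : Set.range e = Set.range e') :
    HEq (DeltaSPlus.ofEmb e) (DeltaSPlus.ofEmb e') := by
  obtain ⟨rfl, rfl⟩ := emb_eq_of_range e e' he
  rfl

theorem epiHom_heq {r₁ r₂ s₁ s₂ : ℕ} {Y Y' : DeltaSPlus} {e₁ : Fin r₁ ↪o Fin Y.card}
    {e₂ : Fin r₂ ↪o Fin Y.card} {e₁' : Fin s₁ ↪o Fin Y'.card} {e₂' : Fin s₂ ↪o Fin Y'.card}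
    (h : Set.range e₁ = Set.range e₂) (h' : Set.range e₁' = Set.range e₂') {g : Y ⟶ Y'}
    {m₁ : (⟨DeltaSPlus.mk r₁⟩ : EpiDeltaSPlus) ⟶ ⟨DeltaSPlus.mk s₁⟩}
    {m₂ : (⟨DeltaSPlus.mk r₂⟩ : EpiDeltaSPlus) ⟶ ⟨DeltaSPlus.mk s₂⟩}
    (h₁ : m₁.hom ≫ DeltaSPlus.ofEmb e₁' = DeltaSPlus.ofEmb e₁ ≫ g)
    (h₂ : m₂.hom ≫ DeltaSPlus.ofEmb e₂' = DeltaSPlus.ofEmb e₂ ≫ g) : HEq m₁ m₂ := by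
  obtain ⟨rfl, rfl⟩ := emb_eq_of_range e₁ e₂ h
  obtain ⟨rfl, rfl⟩ := emb_eq_of_range e₁' e₂' h'
  apply heq_of_eq
  apply WideSubcategory.hom_ext
  rw [← cancel_mono (DeltaSPlus.ofEmb e₁'), h₁]
  exact h₂.symm

theorem image_hom_comp {X X' : EpiDeltaSPlus} (p : X ⟶ X') {Y : DeltaSPlus} (f : X'.obj ⟶ Y) :
    TensorMor.image (p.hom ≫ f) = TensorMor.image f :=
  TensorMor.image_comp_of_ne_nil p.hom (EpiDeltaSPlus.word_ne_nil p) f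

theorem range_imageEmb_comp {X X' : EpiDeltaSPlus} (p : X ⟶ X') {Y : DeltaSPlus}
    (f : X'.obj ⟶ Y) : Set.range (TensorMor.imageEmb (p.hom ≫ f)) =
      Set.range (TensorMor.imageEmb f) := by
  rw [TensorMor.range_imageEmb, TensorMor.range_imageEmb]
  exact congrArg _ (image_hom_comp p f)

/-- Precomposition with an epimorphism preserves images, and the maps between images are forced by
their squares. -/
theorem map_comp_imageFunctor {X X' : EpiDeltaSPlus} (p : X ⟶ X') :
    Under.map p.hom ⋙ imageFunctor X = imageFunctor X' ⋙ Under.map p :=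
  structuredArrow_functor_ext (B := Under X'.obj) (𝟭 EpiDeltaSPlus)
    (fun Z => underImage_congr (p.hom ≫ Z.hom) _ (TensorMor.imageEmb Z.hom) _
      (by rw [TensorMor.range_imageEmb]; exact congrArg _ (image_hom_comp p Z.hom).symm))
    (fun {Z W} g => epiHom_heq (range_imageEmb_comp p Z.hom) (range_imageEmb_comp p W.hom)
      (imageFunctorMap_comp ((Under.map p.hom).map g)) (imageFunctorMap_comp g))

theorem ofEmb_refl (Y : DeltaSPlus) :
    DeltaSPlus.ofEmb (OrderIso.refl (Fin Y.card)).toOrderEmbedding = 𝟙 Y := by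
  apply TensorMor.ext
  funext i
  exact TensorMor.ofEmb_word_apply (OrderIso.refl (Fin Y.card)).toOrderEmbedding i

theorem range_refl_eq_image {X Y : EpiDeltaSPlus} (f : X ⟶ Y) :
    Set.range (OrderIso.refl (Fin Y.obj.card)).toOrderEmbedding = TensorMor.image f.hom := by
  rw [TensorMor.image_eq_univ f.hom (EpiDeltaSPlus.word_ne_nil f)]
  simp

/-- An epimorphism has full image, and the only order embedding onto all of its target is the
identity. The equality is strict, which is why `gf` is the identity and not just homotopic to it. -/
theorem post_comp_imageFunctor (X : EpiDeltaSPlus) :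
    Under.post EpiDeltaSPlus.inclusion ⋙ imageFunctor X = 𝟭 (Under X) :=
  structuredArrow_functor_ext (B := Under X) (𝟭 EpiDeltaSPlus)
    (fun Z => underImage_congr Z.hom.hom _ (OrderIso.refl (Fin Z.right.obj.card)).toOrderEmbedding
      (TensorMor.range_imageEmb Z.hom.hom) (range_refl_eq_image Z.hom))
    (fun {Z W} g => epiHom_heq (e₂ := (OrderIso.refl (Fin Z.right.obj.card)).toOrderEmbedding)
      (e₂' := (OrderIso.refl (Fin W.right.obj.card)).toOrderEmbedding)
      ((TensorMor.range_imageEmb Z.hom.hom).trans (range_refl_eq_image Z.hom).symm)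
      ((TensorMor.range_imageEmb W.hom.hom).trans (range_refl_eq_image W.hom).symm)
      (imageFunctorMap_comp ((Under.post EpiDeltaSPlus.inclusion).map g))
      (((congrArg (g.right.hom ≫ ·) (ofEmb_refl W.right.obj)).trans (Category.comp_id _)).trans
        ((congrArg (· ≫ g.right.hom) (ofEmb_refl Z.right.obj)).trans (Category.id_comp _)).symm))

end EpiDeltaSPlus

/-! ### The splitting `A = k ⊕ I` on tensor powers. -/

section

variable {k : Type u} [CommRing k] {A : Type u} [Ring A] [Algebra k A] (ε : A →ₐ[k] k)

/-- The projection `a ↦ a - ε(a)` of `A` onto the augmentation ideal. -/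
def augProj : A →ₗ[k] augIdeal ε :=
  LinearMap.codRestrict _ (LinearMap.id - (Algebra.linearMap k A) ∘ₗ ε.toLinearMap) (by
    intro a
    simp)

theorem augProj_coe (a : A) : (augProj ε a : A) = a - algebraMap k A (ε a) := rfl

theorem augProj_one : augProj ε (1 : A) = 0 := by
  apply Subtype.ext
  simp [augProj_coe]

theorem augProj_of_mem (a : A) (ha : a ∈ augIdeal ε) : augProj ε a = ⟨a, ha⟩ := by
  apply Subtype.ext
  have : ε a = 0 := ha
  simp [augProj_coe, this]

/-- The indices outside the range of `e`. -/
def outsideRange {r q : ℕ} (e : Fin r ↪o Fin q) : Finset (Fin q) :=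
  Finset.univ \ Finset.univ.map e.toEmbedding

theorem mem_outsideRange {r q : ℕ} (e : Fin r ↪o Fin q) (i : Fin q) :
    i ∈ outsideRange e ↔ i ∉ Set.range e := by
  simp [outsideRange]

/-- The projection `A^{⊗q} → I^{⊗r}` applying `augProj` to the factors in the range of `e` and
`ε` to the other ones. -/
noncomputable def tensorProj {r q : ℕ} (e : Fin r ↪o Fin q) :
    (⨂[k] _ : Fin q, A) →ₗ[k] (⨂[k] _ : Fin r, augIdeal ε) :=
  -- Multilinearity in the slot `j`: outside the range of `e` only the scalar involves `a j`, and
  -- inside the range only one tensor factor does.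
  have hout : ∀ [DecidableEq (Fin q)] (a : Fin q → A) (j : Fin q) (_ : j ∉ Set.range e) (x : A),
      (fun b => augProj ε (Function.update a j x (e b))) = fun b => augProj ε (a (e b)) := by
    intro _ a j hj x
    funext b
    rw [Function.update_of_ne]
    rintro rfl
    exact hj ⟨b, rfl⟩
  have hprod : ∀ [DecidableEq (Fin q)] (a : Fin q → A) (j : Fin q) (_ : j ∉ Set.range e),
      ∃ C : k, ∀ x : A, ∏ i ∈ outsideRange e, ε (Function.update a j x i) = ε x * C := by
    intro _ a j hj
    refine ⟨∏ i ∈ outsideRange e \ {j}, ε (a i), fun x => ?_⟩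
    rw [← Finset.prod_update_of_mem ((mem_outsideRange e j).2 hj)]
    apply Finset.prod_congr rfl
    intro i _
    by_cases hi : i = j
    · subst hi; simp
    · simp [Function.update_of_ne hi]
  have hin : ∀ [DecidableEq (Fin q)] (a : Fin q → A) (b : Fin r) (x : A),
      (fun b' => augProj ε (Function.update a (e b) x (e b'))) =
        Function.update (fun b' => augProj ε (a (e b'))) b (augProj ε x) := by
    intro _ a b x
    funext b'
    by_cases hb : b' = b
    · subst hb; simp
    · rw [Function.update_of_ne hb, Function.update_of_ne (fun h => hb (e.injective h))]
  have hprod' : ∀ [DecidableEq (Fin q)] (a : Fin q → A) (b : Fin r) (x : A),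
      ∏ i ∈ outsideRange e, ε (Function.update a (e b) x i) = ∏ i ∈ outsideRange e, ε (a i) := by
    intro _ a b x
    apply Finset.prod_congr rfl
    intro i hi
    rw [Function.update_of_ne]
    rintro rfl
    exact (mem_outsideRange e _).1 hi ⟨b, rfl⟩
  PiTensorProduct.lift
    { toFun := fun a => (∏ i ∈ outsideRange e, ε (a i)) •
        PiTensorProduct.tprod k fun b => augProj ε (a (e b))
      map_update_add' := fun a j x y => by
        by_cases hj : j ∈ Set.range e
        · obtain ⟨b, rfl⟩ := hj
          simp only [hin, hprod', map_add, MultilinearMap.map_update_add, smul_add]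
        · obtain ⟨C, hC⟩ := hprod a j hj
          simp only [hout _ _ hj, hC, map_add, add_mul, add_smul]
      map_update_smul' := fun a j c x => by
        by_cases hj : j ∈ Set.range e
        · obtain ⟨b, rfl⟩ := hj
          simp only [hin, hprod', map_smul, MultilinearMap.map_update_smul]
          rw [smul_comm]
        · obtain ⟨C, hC⟩ := hprod a j hj
          simp only [hout _ _ hj, hC, map_smul, smul_eq_mul, mul_assoc]
          rw [mul_smul] }

theorem tensorProj_tprod {r q : ℕ} (e : Fin r ↪o Fin q) (a : Fin q → A) :
    tensorProj ε e (PiTensorProduct.tprod k a) =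
      (∏ i ∈ outsideRange e, ε (a i)) • PiTensorProduct.tprod k fun b => augProj ε (a (e b)) :=
  PiTensorProduct.lift.tprod _

theorem eval_mem_augIdeal {p q : ℕ} (g : TensorMor p q) (z : Fin p → augIdeal ε) {i : Fin q}
    (hi : i ∈ g.image) : g.eval (fun j => (z j : A)) i ∈ augIdeal ε :=
  augIdeal_list_prod_mem ε _ ((g.mem_image i).1 hi) z

theorem eval_eq_one {p q : ℕ} (g : TensorMor p q) (z : Fin p → A) {i : Fin q}
    (hi : i ∉ g.image) : g.eval z i = 1 := by
  rw [TensorMor.mem_image, not_not] at hi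
  simp [TensorMor.eval, hi]

/-- The tensor `g(z)` has entries in `I` on the image of `g` and `1` elsewhere. If `e` meets a `1`,
then `augProj` kills it; otherwise `e` misses an entry in `I`, and `ε` kills that one. -/
theorem tensorProj_of_ne {p q r : ℕ} (g : TensorMor p q) (e : Fin r ↪o Fin q)
    (he : Set.range e ≠ g.image) (z : Fin p → augIdeal ε) :
    tensorProj ε e (PiTensorProduct.tprod k (g.eval fun j => (z j : A))) = 0 := by
  rw [tensorProj_tprod]
  by_cases h : ∃ b, e b ∉ g.image
  · obtain ⟨b, hb⟩ := h
    rw [MultilinearMap.map_coord_zero (PiTensorProduct.tprod k) b, smul_zero]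
    rw [eval_eq_one g _ hb, augProj_one]
  · push Not at h
    obtain ⟨i, hi, hi'⟩ : ∃ i ∈ g.image, i ∉ Set.range e := by
      by_contra! hc
      apply he
      ext i
      constructor
      · rintro ⟨b, rfl⟩
        exact h b
      · exact hc i
    rw [Finset.prod_eq_zero (i := i), zero_smul]
    · exact (mem_outsideRange e i).2 hi'
    · exact eval_mem_augIdeal ε g z hi

theorem tensorProj_of_eq {p q r : ℕ} (g : TensorMor p q) (e : Fin r ↪o Fin q)
    (he : Set.range e = g.image) (z : Fin p → augIdeal ε)
    (h₁ : ∀ i ∈ g.image, i ∈ Set.range e) (h₂ : ∀ i, (g.restrict e h₁).word i ≠ []) :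
    tensorProj ε e (PiTensorProduct.tprod k (g.eval fun j => (z j : A))) =
      augTensorMap ε (g.restrict e h₁) h₂ (PiTensorProduct.tprod k z) := by
  have hb : ∀ b, e b ∈ g.image := fun b => by
    rw [← Finset.mem_coe, ← he]
    exact ⟨b, rfl⟩
  rw [tensorProj_tprod, augTensorMap_tprod, Finset.prod_eq_one, one_smul]
  · congr 1
    funext b
    exact augProj_of_mem ε _ (eval_mem_augIdeal ε g z (hb b))
  · intro i hi
    rw [eval_eq_one, map_one]
    rw [← Finset.mem_coe, ← he]
    exact (mem_outsideRange e i).1 hi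

/-- Expanding `a = (a - ε(a)) + ε(a) · 1` slot by slot shows that `A^{⊗q}` is spanned by pure
tensors with every entry either `1` or in `I`. These are the values of the monomorphisms of `Δ₊` on
tensors from `I`. -/
theorem tensorPower_hom_ext {q : ℕ} {V : Type*} [AddCommGroup V] [Module k V]
    {φ ψ : (⨂[k] _ : Fin q, A) →ₗ[k] V}
    (h : ∀ (r : ℕ) (e : Fin r ↪o Fin q) (z : Fin r → augIdeal ε),
      φ (PiTensorProduct.tprod k ((TensorMor.ofEmb e).eval fun j => (z j : A))) =
        ψ (PiTensorProduct.tprod k ((TensorMor.ofEmb e).eval fun j => (z j : A)))) : φ = ψ := by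
  classical
  -- `s` contains the slots that still have to be expanded.
  have key : ∀ (s : Finset (Fin q)) (a : Fin q → A),
      (∀ i ∉ s, a i = 1 ∨ a i ∈ augIdeal ε) →
        φ (PiTensorProduct.tprod k a) = ψ (PiTensorProduct.tprod k a) := by
    intro s
    induction s using Finset.induction with
    | empty =>
      intro a ha
      -- Nothing is left to expand: `a` comes from the slots in `S`, and every other entry is `1`.
      let S : Finset (Fin q) := Finset.univ.filter fun i => a i ∈ augIdeal ε
      let e : Fin S.card ↪o Fin q := S.orderEmbOfFin rfl
      have he : ∀ i, i ∈ Set.range e ↔ a i ∈ augIdeal ε := by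
        intro i
        rw [show Set.range e = S from S.range_orderEmbOfFin rfl]
        simp [S]
      have hz := h S.card e (fun b => ⟨a (e b), (he _).1 ⟨b, rfl⟩⟩)
      have ha' : ((TensorMor.ofEmb e).eval fun b => a (e b)) = a := by
        funext i
        by_cases hi : i ∈ Set.range e
        · obtain ⟨b, rfl⟩ := hi
          simp [TensorMor.eval, TensorMor.ofEmb_word_apply]
        · rw [TensorMor.eval, TensorMor.ofEmb_word_eq_nil e hi]
          rcases ha i (Finset.notMem_empty i) with h1 | h1
          · simp [h1]
          · exact absurd ((he i).2 h1) hi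
      rw [← ha']
      exact hz
    | insert i s _ ih =>
      intro a ha
      have h1 : a = Function.update a i ((augProj ε (a i) : A) + ε (a i) • (1 : A)) := by
        rw [augProj_coe, Algebra.algebraMap_eq_smul_one, sub_add_cancel, Function.update_eq_self]
      have hupd : ∀ x : A, (x = 1 ∨ x ∈ augIdeal ε) →
          ∀ j ∉ s, Function.update a i x j = 1 ∨ Function.update a i x j ∈ augIdeal ε := by
        intro x hx j hj
        by_cases hji : j = i
        · subst hji
          simpa using hx
        · rw [Function.update_of_ne hji]
          exact ha j (by simp [hji, hj])
      rw [h1, MultilinearMap.map_update_add, MultilinearMap.map_update_smul, map_add, map_add,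
        map_smul, map_smul, ih _ (hupd _ (Or.inr (augProj ε (a i)).2)), ih _ (hupd _ (Or.inl rfl))]
  apply PiTensorProduct.ext
  ext a
  exact key Finset.univ a (fun i hi => absurd (Finset.mem_univ i) hi)

end

/-! ### Change of categories from `Epi ΔS₊` to `ΔS₊`. -/

section

variable {k : Type u} [CommRing k] {A : Type u} [Ring A] [Algebra k A] (ε : A →ₐ[k] k)
variable (M : DeltaSPlusᵒᵖ ⥤ ModuleCat.{u} k)

/-- The comparison `M ⊗_{Epi ΔS₊} B(I) → M ⊗_{ΔS₊} B(A)`. -/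
noncomputable abbrev idealComparison :
    CatTensor (EpiDeltaSPlus.inclusion.op ⋙ M) (symBarIdeal ε) →ₗ[k]
      CatTensor M (symBarPlus k A) :=
  CatTensor.mapAlong EpiDeltaSPlus.inclusion (𝟙 (EpiDeltaSPlus.inclusion.op ⋙ M))
    (symBarIdealInclusion ε)

/-- The summand of the inverse of the comparison indexed by an order embedding. -/
noncomputable def idealBilinSummand (Y : DeltaSPlus) {r : ℕ} (e : Fin r ↪o Fin Y.card) :
    M.obj (op Y) →ₗ[k] (symBarPlus k A).obj Y →ₗ[k]
      CatTensor (EpiDeltaSPlus.inclusion.op ⋙ M) (symBarIdeal ε) :=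
  (CatTensor.tmulBilin (EpiDeltaSPlus.inclusion.op ⋙ M) (symBarIdeal ε) ⟨DeltaSPlus.mk r⟩).compl₁₂
    (M.map (DeltaSPlus.ofEmb e).op).hom (tensorProj ε e)

theorem idealBilinSummand_of_ne {X : EpiDeltaSPlus} {Y : DeltaSPlus} (g : X.obj ⟶ Y) {r : ℕ}
    (e : Fin r ↪o Fin Y.card) (he : Set.range e ≠ TensorMor.image g) (y : M.obj (op Y))
    (z : Fin X.obj.card → augIdeal ε) :
    idealBilinSummand ε M Y e y
      (PiTensorProduct.tprod k (TensorMor.eval g fun j => (z j : A))) = 0 := by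
  refine Eq.trans (congrArg (CatTensor.tmulBilin (EpiDeltaSPlus.inclusion.op ⋙ M) (symBarIdeal ε)
    ⟨DeltaSPlus.mk r⟩ ((M.map (DeltaSPlus.ofEmb e).op).hom y)) (tensorProj_of_ne ε g e he z)) ?_
  exact map_zero _

/-- The projection of `g(z)` is the action on `z` of the epimorphic factor of `g`. Moving this
factor across the tensor product over `Epi ΔS₊` reassembles `g` on the left. -/
theorem idealBilinSummand_of_eq {X : EpiDeltaSPlus} {Y : DeltaSPlus} (g : X.obj ⟶ Y) {r : ℕ}
    (e : Fin r ↪o Fin Y.card) (he : Set.range e = TensorMor.image g) (y : M.obj (op Y))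
    (z : Fin X.obj.card → augIdeal ε) :
    idealBilinSummand ε M Y e y
      (PiTensorProduct.tprod k (TensorMor.eval g fun j => (z j : A))) =
      CatTensor.tmul (EpiDeltaSPlus.inclusion.op ⋙ M) (symBarIdeal ε) X ((M.map g.op).hom y)
        (PiTensorProduct.tprod k z) := by
  let f : X ⟶ (⟨DeltaSPlus.mk r⟩ : EpiDeltaSPlus) :=
    ⟨DeltaSPlus.corestrict g e he, DeltaSPlus.epi_corestrict g e he⟩
  refine Eq.trans (congrArg (CatTensor.tmulBilin (EpiDeltaSPlus.inclusion.op ⋙ M) (symBarIdeal ε)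
    ⟨DeltaSPlus.mk r⟩ ((M.map (DeltaSPlus.ofEmb e).op).hom y))
      (tensorProj_of_eq ε g e he z (fun i hi => by rwa [he]) (EpiDeltaSPlus.word_ne_nil f))) ?_
  refine (CatTensor.tmul_map (EpiDeltaSPlus.inclusion.op ⋙ M) (symBarIdeal ε) f
    ((M.map (DeltaSPlus.ofEmb e).op).hom y) (PiTensorProduct.tprod k z)).trans ?_
  refine congrArg (fun t => CatTensor.tmul (EpiDeltaSPlus.inclusion.op ⋙ M) (symBarIdeal ε) X t
    (PiTensorProduct.tprod k z)) ?_
  refine (congrArg (fun t => t.hom y) (M.map_comp (DeltaSPlus.ofEmb e).op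
    (DeltaSPlus.corestrict g e he).op)).symm.trans ?_
  rw [← op_comp, DeltaSPlus.corestrict_comp_ofEmb]

/-- The bilinear map inducing the inverse of the comparison. -/
noncomputable def idealBilin (Y : DeltaSPlus) :
    M.obj (op Y) →ₗ[k] (symBarPlus k A).obj Y →ₗ[k]
      CatTensor (EpiDeltaSPlus.inclusion.op ⋙ M) (symBarIdeal ε) :=
  -- One term for each summand `I^{⊗S}` of the tensor power of `A`.
  ∑ S : Finset (Fin Y.card), idealBilinSummand ε M Y (S.orderEmbOfFin rfl)

theorem idealBilin_apply (Y : DeltaSPlus) (y : M.obj (op Y)) (x : (symBarPlus k A).obj Y) :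
    idealBilin ε M Y y x =
      ∑ S : Finset (Fin Y.card), idealBilinSummand ε M Y (S.orderEmbOfFin rfl) y x := by
  rw [idealBilin, LinearMap.sum_apply, LinearMap.sum_apply]

/-- Only the subset `S = image g` contributes. The formula is needed for every `g`, not only for
monomorphisms of `Δ₊`, since balancedness applies it to the composite of such a monomorphism with an
arbitrary morphism. -/
theorem idealBilin_tprod_eval {X : EpiDeltaSPlus} {Y : DeltaSPlus} (g : X.obj ⟶ Y)
    (y : M.obj (op Y)) (z : Fin X.obj.card → augIdeal ε) :
    idealBilin ε M Y y (PiTensorProduct.tprod k (TensorMor.eval g fun j => (z j : A))) =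
      CatTensor.tmul (EpiDeltaSPlus.inclusion.op ⋙ M) (symBarIdeal ε) X ((M.map g.op).hom y)
        (PiTensorProduct.tprod k z) := by
  refine (idealBilin_apply ε M Y y _).trans
    ((Finset.sum_eq_single (TensorMor.image g) (fun S _ hS => ?_) fun h =>
      absurd (Finset.mem_univ _) h).trans ?_)
  · refine idealBilinSummand_of_ne ε M g _ ?_ y z
    rw [Finset.range_orderEmbOfFin]
    exact fun h => hS (Finset.coe_injective h)
  · exact idealBilinSummand_of_eq ε M g _ (Finset.range_orderEmbOfFin _ rfl) y z

theorem idealBilin_balanced {Y Y' : DeltaSPlus} (f : Y ⟶ Y') (y : M.obj (op Y'))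
    (x : (symBarPlus k A).obj Y) :
    idealBilin ε M Y' y (((symBarPlus k A).map f).hom x) =
      idealBilin ε M Y ((M.map f.op).hom y) x := by
  refine congrArg (fun t => t x) (tensorPower_hom_ext (q := Y.card) ε
    (φ := idealBilin ε M Y' y ∘ₗ ((symBarPlus k A).map f).hom)
    (ψ := idealBilin ε M Y ((M.map f.op).hom y)) fun r e z => ?_)
  let X : EpiDeltaSPlus := ⟨DeltaSPlus.mk r⟩
  have h₁ := idealBilin_tprod_eval ε M (X := X) (DeltaSPlus.ofEmb e ≫ f) y z
  have h₂ := idealBilin_tprod_eval ε M (X := X) (DeltaSPlus.ofEmb e) ((M.map f.op).hom y) z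
  have h₃ : ((symBarPlus k A).map f).hom
      (PiTensorProduct.tprod k ((TensorMor.ofEmb e).eval fun j => (z j : A))) =
      PiTensorProduct.tprod k (TensorMor.eval (DeltaSPlus.ofEmb e ≫ f) fun j => (z j : A)) :=
    (TensorMor.tensorMap_tprod k A f _).trans
      (congrArg (PiTensorProduct.tprod k) (TensorMor.eval_comp _ (TensorMor.ofEmb e) f _).symm)
  refine (congrArg (idealBilin ε M Y' y) h₃).trans (h₁.trans (Eq.trans ?_ h₂.symm))
  rw [op_comp, M.map_comp]
  rfl

/-- The inverse of the comparison. -/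
noncomputable def idealComparisonInv :
    CatTensor M (symBarPlus k A) →ₗ[k]
      CatTensor (EpiDeltaSPlus.inclusion.op ⋙ M) (symBarIdeal ε) :=
  CatTensor.lift (idealBilin ε M) (idealBilin_balanced ε M)

theorem idealComparisonInv_tmul_tprod {X : EpiDeltaSPlus} {Y : DeltaSPlus} (g : X.obj ⟶ Y)
    (y : M.obj (op Y)) (z : Fin X.obj.card → augIdeal ε) :
    idealComparisonInv ε M (CatTensor.tmul M (symBarPlus k A) Y y
      (PiTensorProduct.tprod k (TensorMor.eval g fun j => (z j : A)))) =
      CatTensor.tmul (EpiDeltaSPlus.inclusion.op ⋙ M) (symBarIdeal ε) X ((M.map g.op).hom y)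
        (PiTensorProduct.tprod k z) :=
  (CatTensor.lift_tmul _ _ Y y _).trans (idealBilin_tprod_eval ε M g y z)

theorem idealComparison_tmul_tprod {X : EpiDeltaSPlus} (y : M.obj (op X.obj))
    (z : Fin X.obj.card → augIdeal ε) :
    idealComparison ε M (CatTensor.tmul (EpiDeltaSPlus.inclusion.op ⋙ M) (symBarIdeal ε) X y
      (PiTensorProduct.tprod k z)) =
      CatTensor.tmul M (symBarPlus k A) X.obj y
        (PiTensorProduct.tprod k fun j => (z j : A)) :=
  (CatTensor.mapAlong_tmul EpiDeltaSPlus.inclusion (𝟙 (EpiDeltaSPlus.inclusion.op ⋙ M))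
    (symBarIdealInclusion ε) X y _).trans
    (congrArg (CatTensor.tmul M (symBarPlus k A) X.obj y) (PiTensorProduct.map_tprod _ _))

theorem idealComparisonInv_comp :
    idealComparisonInv ε M ∘ₗ idealComparison ε M = LinearMap.id := by
  refine CatTensor.hom_ext_bilin fun X => LinearMap.ext fun y => ?_
  refine PiTensorProduct.ext (MultilinearMap.ext fun z => ?_)
  refine (congrArg (idealComparisonInv ε M) (idealComparison_tmul_tprod ε M y z)).trans ?_
  have h := idealComparisonInv_tmul_tprod ε M (𝟙 X.obj) y z
  have h' : TensorMor.eval (𝟙 X.obj : X.obj ⟶ X.obj) (fun j => (z j : A)) = fun j => (z j : A) :=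
    TensorMor.eval_id _ _
  rw [h', op_id, M.map_id] at h
  exact h

theorem idealComparison_comp_inv :
    idealComparison ε M ∘ₗ idealComparisonInv ε M = LinearMap.id := by
  refine CatTensor.hom_ext_bilin fun Y => LinearMap.ext fun y => ?_
  refine tensorPower_hom_ext (q := Y.card) ε fun r e z => ?_
  let X : EpiDeltaSPlus := ⟨DeltaSPlus.mk r⟩
  have h := idealComparisonInv_tmul_tprod ε M (X := X) (DeltaSPlus.ofEmb e) y z
  refine (congrArg (idealComparison ε M) h).trans ?_
  refine (idealComparison_tmul_tprod ε M (X := X) _ z).trans ?_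
  -- Over `ΔS₊` the embedding `e` may cross the tensor sign, which turns `e^* y ⊗ z` back into `y ⊗
  -- e(z)`.
  refine (CatTensor.tmul_map M (symBarPlus k A) (DeltaSPlus.ofEmb e) y _).symm.trans ?_
  exact congrArg (CatTensor.tmul M (symBarPlus k A) Y y) (TensorMor.tensorMap_tprod k A _ _)

instance isIso_ofHom_idealComparison : IsIso (ModuleCat.ofHom (idealComparison ε M)) :=
  ⟨ModuleCat.ofHom (idealComparisonInv ε M),
    ModuleCat.hom_ext (idealComparisonInv_comp ε M),
    ModuleCat.hom_ext (idealComparison_comp_inv ε M)⟩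

end

/-! ### Naturality of the prisms on image inclusions. -/

theorem prismChain_hcongr {D : Type} [SmallCategory D] {n : ℕ} {F F' G G' : ComposableArrows D n}
    (hF : F = F') (hG : G = G') (η : F ⟶ G) (η' : F' ⟶ G') (h : ∀ i, HEq (η.app i) (η'.app i))
    (j : Fin (n + 1)) : prismChain η j = prismChain η' j := by
  subst hF hG
  congr 1
  ext i
  exact eq_of_heq (h i)

namespace EpiDeltaSPlus

/-- The image functors are natural. -/
def imageNat : EpiDeltaSPlus.inclusion.op ⋙ Under.mapFunctor DeltaSPlus ⟶
    Under.mapFunctor EpiDeltaSPlus where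
  app X := (imageFunctor X.unop).toCatHom
  naturality _ _ p := Cat.ext (map_comp_imageFunctor p.unop)

/-- The inclusion functors are natural. -/
def postNat : Under.mapFunctor EpiDeltaSPlus ⟶
    EpiDeltaSPlus.inclusion.op ⋙ Under.mapFunctor DeltaSPlus where
  app X := (Under.post (X := X.unop) EpiDeltaSPlus.inclusion).toCatHom
  naturality _ _ p := Cat.ext (under_map_post EpiDeltaSPlus.inclusion p.unop)

theorem postNat_comp_imageNat : postNat ≫ imageNat = 𝟙 _ := by
  ext X : 2
  exact Cat.ext (post_comp_imageFunctor X.unop)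

/-- The images before and after precomposition with `p` coincide, and their inclusions are order
embeddings with equal ranges. This is what lets the homotopy descend to the tensor product over `Epi
ΔS₊`. -/
theorem prismChain_imageInclusion {X X' : EpiDeltaSPlus} (p : X ⟶ X') {n : ℕ}
    (c : ComposableArrows (Under X'.obj) n) (j : Fin (n + 1)) :
    prismChain (Functor.whiskerLeft c (imageInclusion X')) j ⋙ Under.map p.hom =
      prismChain (Functor.whiskerLeft (c ⋙ Under.map p.hom) (imageInclusion X)) j := by
  rw [← prismChain_whiskerRight]
  have hF : (c ⋙ imageFunctor X' ⋙ Under.post EpiDeltaSPlus.inclusion) ⋙ Under.map p.hom =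
      (c ⋙ Under.map p.hom) ⋙ imageFunctor X ⋙ Under.post EpiDeltaSPlus.inclusion := by
    change c ⋙ imageFunctor X' ⋙ (Under.post EpiDeltaSPlus.inclusion ⋙ Under.map p.hom) =
      c ⋙ (Under.map p.hom ⋙ imageFunctor X) ⋙ Under.post EpiDeltaSPlus.inclusion
    rw [map_comp_imageFunctor]
    exact congrArg (fun T => c ⋙ imageFunctor X' ⋙ T)
      (under_map_post EpiDeltaSPlus.inclusion p).symm
  exact prismChain_hcongr hF rfl _ _ (fun i => structuredArrow_hom_heq (𝟭 DeltaSPlus)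
    (congrArg (fun F => F.obj i) hF) rfl
    (ofEmb_heq _ _ (range_imageEmb_comp p (c.obj i).hom).symm)) j

end EpiDeltaSPlus

/-! ### The retraction, the homotopy and their values on chains. -/

section

variable {k : Type u} [CommRing k] {A : Type u} [Ring A] [Algebra k A] (ε : A →ₐ[k] k)

variable (k) in
/-- The simplicial `(Epi ΔS₊)ᵒᵖ`-module of chains in the categories `X ↓ ΔS₊`. -/
noncomputable abbrev restrictedUnderNerve :
    SimplicialObject (EpiDeltaSPlusᵒᵖ ⥤ ModuleCat.{u} k) :=
  nerveModule k (EpiDeltaSPlus.inclusion.op ⋙ Under.mapFunctor DeltaSPlus)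

/-- The comparison `k[N(- \ ΔS₊)] ⊗_{Epi ΔS₊} B(I) ⟶ k[N(- \ ΔS₊)] ⊗_{ΔS₊} B(A)`. -/
noncomputable def yPlusComparison :
    simplicialTensor (symBarIdeal ε) (restrictedUnderNerve k) ⟶ YPlus k A :=
  simplicialMapAlong (R := underNerveModule k DeltaSPlus) EpiDeltaSPlus.inclusion
    (symBarIdealInclusion ε) (𝟙 (restrictedUnderNerve k))

instance : IsIso (yPlusComparison ε) :=
  (NatTrans.isIso_iff_isIso_app _).2 fun Δ =>
    isIso_ofHom_idealComparison ε ((underNerveModule k DeltaSPlus).obj Δ)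

theorem yPlusComparison_tmul (Δ : SimplexCategoryᵒᵖ) (X : EpiDeltaSPlus)
    (x : ((restrictedUnderNerve k).obj Δ).obj (op X)) (y : (symBarIdeal ε).obj X) :
    ((yPlusComparison ε).app Δ).hom
      (CatTensor.tmul ((restrictedUnderNerve k).obj Δ) (symBarIdeal ε) X x y) =
      CatTensor.tmul ((underNerveModule k DeltaSPlus).obj Δ) (symBarPlus k A) X.obj x
        (((symBarIdealInclusion ε).app X).hom y) :=
  CatTensor.mapAlong_tmul (M := (underNerveModule k DeltaSPlus).obj Δ)
    (M' := (restrictedUnderNerve k).obj Δ) EpiDeltaSPlus.inclusion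
    (𝟙 (EpiDeltaSPlus.inclusion.op ⋙ (underNerveModule k DeltaSPlus).obj Δ))
    (symBarIdealInclusion ε) X x y

/-- The action on tensor products of maps of simplicial `(Epi ΔS₊)ᵒᵖ`-modules. -/
noncomputable abbrev tensorIdealMap {R R' : SimplicialObject (EpiDeltaSPlusᵒᵖ ⥤ ModuleCat.{u} k)}
    (f : R ⟶ R') : simplicialTensor (symBarIdeal ε) R ⟶ simplicialTensor (symBarIdeal ε) R' :=
  ((SimplicialObject.whiskering _ _).obj (tensorFunctor (symBarIdeal ε))).map f

theorem tensorFunctor_map_tmul {C : Type} [SmallCategory C] (N : C ⥤ ModuleCat.{u} k)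
    {M M' : Cᵒᵖ ⥤ ModuleCat.{u} k} (f : M ⟶ M') (X : C) (y : M.obj (op X)) (x : N.obj X) :
    ((tensorFunctor N).map f).hom (CatTensor.tmul M N X y x) =
      CatTensor.tmul M' N X ((f.app (op X)).hom y) x :=
  CatTensor.mapAlong_tmul (𝟭 C) (M := M') (N := N) (M' := M) (N' := N) f (𝟙 N) X y x

/-- Splits the inclusion into an enlargement of the nerves over the fixed base `Epi ΔS₊`, followed
by the change of base, which is an isomorphism. Only the first factor has to be inverted up to
homotopy. -/
theorem YEpi.inclusion_eq : YEpi.inclusion ε =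
    tensorIdealMap ε (nerveModule.map EpiDeltaSPlus.postNat) ≫ yPlusComparison ε := by
  ext Δ : 2
  refine CatTensor.hom_ext fun X y x => ?_
  refine (CatTensor.mapAlong_tmul _ _ _ X y x).trans ?_
  refine Eq.trans ?_ (congrArg ((yPlusComparison ε).app Δ).hom
    (tensorFunctor_map_tmul (symBarIdeal ε)
      ((nerveModule.map EpiDeltaSPlus.postNat).app Δ) X y x)).symm
  exact (yPlusComparison_tmul ε Δ X _ x).symm

/-- The retraction `Y⁺_* A ⟶ Y^{epi}_* A` replacing chains by their images. -/
noncomputable def YEpi.retraction : YPlus k A ⟶ YEpi ε :=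
  inv (yPlusComparison ε) ≫ tensorIdealMap ε (nerveModule.map EpiDeltaSPlus.imageNat)

section

variable {S D : Type*} [Category S] [Category D] (T : S ⥤ D) {P R : S} {Y : D}
  (p : P ⟶ R) (i : R ⟶ P) (Φ : T.obj R ⟶ Y) [IsIso Φ]

theorem comp_conj_eq_id (h : p ≫ i = 𝟙 P) :
    (T.map p ≫ Φ) ≫ inv Φ ≫ T.map i = 𝟙 (T.obj P) := by
  rw [Category.assoc, IsIso.hom_inv_id_assoc, ← T.map_comp, h, T.map_id]

theorem conj_comp_eq {r : R ⟶ R} (h : r = i ≫ p) :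
    (inv Φ ≫ T.map i) ≫ T.map p ≫ Φ = inv Φ ≫ T.map r ≫ Φ := by
  rw [h, T.map_comp, Category.assoc, Category.assoc]

theorem id_eq_conj {r : R ⟶ R} (h : r = 𝟙 R) : 𝟙 Y = inv Φ ≫ T.map r ≫ Φ := by
  rw [h, T.map_id, Category.id_comp, IsIso.inv_hom_id]

end

theorem YEpi.inclusion_comp_retraction : YEpi.inclusion ε ≫ YEpi.retraction ε = 𝟙 (YEpi ε) := by
  rw [YEpi.inclusion_eq]
  refine comp_conj_eq_id
    ((SimplicialObject.whiskering _ _).obj (tensorFunctor (symBarIdeal ε))) _ _ _ ?_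
  exact (nerveModule.map_comp _ _).symm.trans
    ((congrArg _ EpiDeltaSPlus.postNat_comp_imageNat).trans nerveModule.map_id)

/-- The homotopy given by the inclusions of images. -/
noncomputable def imageHomotopy : SimplicialObject.Homotopy
    (nerveModule.map (k := k) (EpiDeltaSPlus.imageNat ≫ EpiDeltaSPlus.postNat))
    (nerveModule.map (k := k) (𝟙 (EpiDeltaSPlus.inclusion.op ⋙ Under.mapFunctor DeltaSPlus))) :=
  nerveModule.homotopy (fun X => EpiDeltaSPlus.imageInclusion X.unop)
    (fun p _ c j => EpiDeltaSPlus.prismChain_imageInclusion p.unop c j)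

theorem retraction_comp_inclusion_eq :
    YEpi.retraction ε ≫ YEpi.inclusion ε = inv (yPlusComparison ε) ≫
      tensorIdealMap ε (nerveModule.map (EpiDeltaSPlus.imageNat ≫ EpiDeltaSPlus.postNat)) ≫
        yPlusComparison ε := by
  rw [YEpi.inclusion_eq]
  exact conj_comp_eq ((SimplicialObject.whiskering _ _).obj (tensorFunctor (symBarIdeal ε)))
    _ _ _ (nerveModule.map_comp _ _)

theorem id_yPlus_eq :
    𝟙 (YPlus k A) = inv (yPlusComparison ε) ≫
      tensorIdealMap ε (nerveModule.map
        (𝟙 (EpiDeltaSPlus.inclusion.op ⋙ Under.mapFunctor DeltaSPlus))) ≫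
        yPlusComparison ε :=
  id_eq_conj ((SimplicialObject.whiskering _ _).obj (tensorFunctor (symBarIdeal ε))) _
    nerveModule.map_id

/-- A simplicial homotopy transported along equalities of its endpoints. -/
def CategoryTheory.SimplicialObject.Homotopy.congr {D : Type*} [Category D] {X Y : SimplicialObject D}
    {f f' g g' : X ⟶ Y} (H : SimplicialObject.Homotopy f g) (hf : f' = f) (hg : g' = g) :
    SimplicialObject.Homotopy f' g' where
  h := H.h
  h_zero_comp_δ_zero n := by rw [hg]; exact H.h_zero_comp_δ_zero n
  h_last_comp_δ_last n := by rw [hf]; exact H.h_last_comp_δ_last n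
  h_succ_comp_δ_castSucc_of_lt := H.h_succ_comp_δ_castSucc_of_lt
  h_succ_comp_δ_castSucc_succ := H.h_succ_comp_δ_castSucc_succ
  h_castSucc_comp_δ_succ_of_lt := H.h_castSucc_comp_δ_succ_of_lt
  h_comp_σ_castSucc_of_le := H.h_comp_σ_castSucc_of_le
  h_comp_σ_succ_of_lt := H.h_comp_σ_succ_of_lt

/-- The homotopy between the retraction onto `Y^{epi}_* A` and the identity of `Y⁺_* A`. -/
noncomputable def YEpi.homotopy :
    SimplicialObject.Homotopy (YEpi.retraction ε ≫ YEpi.inclusion ε) (𝟙 (YPlus k A)) :=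
  SimplicialObject.Homotopy.congr
    -- The homotopy lives over `Epi ΔS₊` and is conjugated by the isomorphism with `Y⁺`.
    (((imageHomotopy.whiskerRight (tensorFunctor (symBarIdeal ε))).postcomp
      (yPlusComparison ε)).precomp (inv (yPlusComparison ε)))
    (retraction_comp_inclusion_eq ε) (id_yPlus_eq ε)

variable {X : EpiDeltaSPlus} {n : ℕ} (c : ComposableArrows (Under X.obj) n)
  (y : (symBarIdeal ε).obj X)

/-- The element `c ⊗ y` of `k[N(- \ ΔS₊)] ⊗_{Epi ΔS₊} B(I)`. -/
noncomputable def restrictedChain :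
    simplicialTensor (symBarIdeal ε) (restrictedUnderNerve k) _⦋n⦌ :=
  CatTensor.tmul ((restrictedUnderNerve k).obj (op ⦋n⦌)) (symBarIdeal ε) X
    (Finsupp.single c (1 : k) : _ →₀ k) y

theorem yPlusComparison_restrictedChain :
    ((yPlusComparison ε).app (op ⦋n⦌)).hom (restrictedChain ε c y) =
      barTensor.chain (symBarPlus k A) X.obj c (((symBarIdealInclusion ε).app X).hom y) :=
  yPlusComparison_tmul ε (op ⦋n⦌) X _ y

/-- On a chain with coefficients already in `I` no projection is needed, so the explicit formulas
for `g` and `h` reduce to operations on chains. -/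
theorem inv_yPlusComparison_chain :
    ((inv (yPlusComparison ε)).app (op ⦋n⦌)).hom
      (barTensor.chain (symBarPlus k A) X.obj c (((symBarIdealInclusion ε).app X).hom y)) =
      restrictedChain ε c y := by
  refine (congrArg ((inv (yPlusComparison ε)).app (op ⦋n⦌)).hom
    (yPlusComparison_restrictedChain ε c y)).symm.trans ?_
  exact congrArg (fun t : simplicialTensor (symBarIdeal ε) (restrictedUnderNerve k) ⟶
    simplicialTensor (symBarIdeal ε) (restrictedUnderNerve k) =>
      (NatTrans.app t (op ⦋n⦌)).hom (restrictedChain ε c y)) (IsIso.hom_inv_id (yPlusComparison ε))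

theorem YEpi.retraction_chain :
    ((YEpi.retraction ε).app (op ⦋n⦌)).hom
      (barTensor.chain (symBarPlus k A) X.obj c (((symBarIdealInclusion ε).app X).hom y)) =
      barTensor.chain (symBarIdeal ε) X (c ⋙ EpiDeltaSPlus.imageFunctor X) y := by
  refine (congrArg ((tensorIdealMap ε (nerveModule.map EpiDeltaSPlus.imageNat)).app (op ⦋n⦌)).hom
    (inv_yPlusComparison_chain ε c y)).trans ?_
  refine (tensorFunctor_map_tmul (symBarIdeal ε)
    ((nerveModule.map EpiDeltaSPlus.imageNat).app (op ⦋n⦌)) X _ y).trans ?_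
  exact congrArg (fun t => CatTensor.tmul ((underNerveModule k EpiDeltaSPlus).obj (op ⦋n⦌))
    (symBarIdeal ε) X t y) (freeModule_map_single k _ c 1)

theorem imageHomotopy_single (j : Fin (n + 1)) :
    ((imageHomotopy (k := k).h j).app (op X)).hom (Finsupp.single c (1 : k) : _ →₀ k) =
      (Finsupp.single (prismChain (Functor.whiskerLeft c (EpiDeltaSPlus.imageInclusion X)) j)
        (1 : k) : _ →₀ k) :=
  freeModule_map_single k _ c 1

theorem tensor_imageHomotopy_restrictedChain (j : Fin (n + 1)) :
    ((tensorFunctor (symBarIdeal ε)).map (imageHomotopy.h j)).hom (restrictedChain ε c y) =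
      restrictedChain ε
        (prismChain (Functor.whiskerLeft c (EpiDeltaSPlus.imageInclusion X)) j) y :=
  (tensorFunctor_map_tmul (symBarIdeal ε) (imageHomotopy.h j) X _ y).trans
    (congrArg (fun t => CatTensor.tmul ((restrictedUnderNerve k).obj (op ⦋n + 1⦌))
      (symBarIdeal ε) X t y) (imageHomotopy_single c j))

theorem YEpi.homotopy_h (j : Fin (n + 1)) :
    (YEpi.homotopy ε).h j = (inv (yPlusComparison ε)).app (op ⦋n⦌) ≫
      (tensorFunctor (symBarIdeal ε)).map (imageHomotopy.h j) ≫
        (yPlusComparison ε).app (op ⦋n + 1⦌) := rfl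

theorem YEpi.homotopy_chain (j : Fin (n + 1)) :
    ((YEpi.homotopy ε).h j).hom
      (barTensor.chain (symBarPlus k A) X.obj c (((symBarIdealInclusion ε).app X).hom y)) =
      barTensor.chain (symBarPlus k A) X.obj
        (prismChain (Functor.whiskerLeft c (EpiDeltaSPlus.imageInclusion X)) j)
        (((symBarIdealInclusion ε).app X).hom y) := by
  rw [YEpi.homotopy_h]
  refine (congrArg ((yPlusComparison ε).app (op ⦋n + 1⦌)).hom ((congrArg
    ((tensorFunctor (symBarIdeal ε)).map (imageHomotopy.h j)).hom
      (inv_yPlusComparison_chain ε c y)).trans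
      (tensor_imageHomotopy_restrictedChain ε c y j))).trans ?_
  exact yPlusComparison_restrictedChain ε
    (prismChain (Functor.whiskerLeft c (EpiDeltaSPlus.imageInclusion X)) j) y

/-- A retraction up to simplicial homotopy is a homotopy equivalence of complexes. -/
noncomputable def homotopyEquivOfRetraction {D : Type*} [Category D] [Preadditive D]
    {Y Z : SimplicialObject D} (f : Z ⟶ Y) (g : Y ⟶ Z)
    (h : SimplicialObject.Homotopy (g ≫ f) (𝟙 Y)) (hfg : f ≫ g = 𝟙 Z) :
    HomotopyEquiv ((AlgebraicTopology.alternatingFaceMapComplex D).obj Y)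
      ((AlgebraicTopology.alternatingFaceMapComplex D).obj Z) where
  hom := (AlgebraicTopology.alternatingFaceMapComplex _).map g
  inv := (AlgebraicTopology.alternatingFaceMapComplex _).map f
  homotopyHomInvId := (Homotopy.ofEq (by rw [← Functor.map_comp])).trans
    (h.toChainHomotopy.trans (Homotopy.ofEq (by rw [CategoryTheory.Functor.map_id])))
  homotopyInvHomId := Homotopy.ofEq (by
    rw [← Functor.map_comp, hfg, CategoryTheory.Functor.map_id])

end

theorem mainTheorem2 {k : Type u} [CommRing k] {A : Type u} [Ring A] [Algebra k A]
    (ε : A →ₐ[k] k) :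
    (∀ n : ℕ, Nonempty (symmetricHomology k A n ≅
      ((AlgebraicTopology.alternatingFaceMapComplex (ModuleCat.{u} k)).obj (YEpi ε)).homology n)) ∧
    ∃ (g : YPlus k A ⟶ YEpi ε)
      (h : SimplicialObject.Homotopy (g ≫ YEpi.inclusion ε) (𝟙 (YPlus k A))),
      YEpi.inclusion ε ≫ g = 𝟙 (YEpi ε) ∧
      ∀ (n : ℕ) (X : EpiDeltaSPlus) (c : ComposableArrows (Under X.obj) n),
        ∃ (e : ComposableArrows (Under X) n) (η : e ⋙ Under.post EpiDeltaSPlus.inclusion ⟶ c),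
          (∀ i, Mono (η.app i).right ∧ DeltaSPlus.IsOrdered (η.app i).right) ∧
          ∀ y : (symBarIdeal ε).obj X,
            (g.app (op ⦋n⦌)).hom
                (barTensor.chain (symBarPlus k A) X.obj c
                  (((symBarIdealInclusion ε).app X).hom y)) =
              barTensor.chain (symBarIdeal ε) X e y ∧
            ∀ j : Fin (n + 1),
              (h.h j).hom
                  (barTensor.chain (symBarPlus k A) X.obj c
                    (((symBarIdealInclusion ε).app X).hom y)) =
                barTensor.chain (symBarPlus k A) X.obj (prismChain η j)
                  (((symBarIdealInclusion ε).app X).hom y) := by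
  refine ⟨fun n => ?_, YEpi.retraction ε, YEpi.homotopy ε, YEpi.inclusion_comp_retraction ε,
    -- The chain `e` consists of the images `[r_i]` of `[q]` in the `[q_i]`, and `η` of their
    -- inclusions.
    fun n X c => ⟨c ⋙ EpiDeltaSPlus.imageFunctor X,
      Functor.whiskerLeft c (EpiDeltaSPlus.imageInclusion X), fun i => ⟨?_, ?_⟩,
      fun y => ⟨YEpi.retraction_chain ε c y, YEpi.homotopy_chain ε c y⟩⟩⟩
  · obtain ⟨e⟩ := symmetricHomology_iso_YPlus k A n
    exact ⟨e ≪≫ (homotopyEquivOfRetraction _ _ (YEpi.homotopy ε)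
      (YEpi.inclusion_comp_retraction ε)).toHomologyIso n⟩
  · exact inferInstanceAs (Mono (DeltaSPlus.ofEmb (TensorMor.imageEmb (c.obj i).hom)))
  · exact DeltaSPlus.isOrdered_ofEmb _
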